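/- Let $D=\{(x,y)\in\mathbb R^2 : x^2+y^2<1\}$ be the open unit disk, bounded by the unit circle $S^1$. For distinct $P,Q\in D$ let $v_1,v_2$ be the two points in which the line $PQ$ meets $S^1$, and set $$d'(P,Q)=\frac12\left|\log\frac{|v_1Q|\,|v_2P|}{|v_1P|\,|v_2Q|}\right|,\qquad d'(P,P)=0$$ (the distance of the Beltrami–Klein model). For distinct $P,Q\in D$ and $R\in D$ let $$\Delta_1'(P,Q)=\log\frac{e^{d'(P,Q)}+1}{e^{d'(P,Q)}-1},\qquad \delta(P,Q,R)=\min\{d'(R,S) : S\in D \text{ on the line } PQ\}.$$ For a nonempty compact convex set $U\subset D$ and $v\in S^1$, let $R(v)$ be $v$ rotated counterclockwise by a right angle. For $u\in U$ let $F(u,v)$ be the gradient of the line $uv$ in the coordinates given by the basis $\{v,R(v)\}$, that is, $F(u,v)=b/a$ where $u-v=a\,v+b\,R(v)$. Let $\psi_U(v)\in S^1$ be the point other than $v$ in which $S^1$ meets the line through $v$ with gradient $\min_{u\in U}F(u,v)$; it is the first point $w$ of $S^1$, counterclockwise from $v$, such that the line $vw$ is tangent to $U$. The map $\psi_U$ is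 an orientation preserving homeomorphism of $S^1$. Identify $S^1$ with $\mathbb R/\mathbb Z$ by $x\mapsto(\cos 2\pi x,\sin 2\pi x)$. For an orientation preserving homeomorphism $g$ of $S^1$ let $\overline g:\mathbb R\to\mathbb R$ be its lift with $\overline g(0)\in[0,1)$, and let $\rho(g)=\lim_{n\to\infty}\frac{\overline g^{\,n}(x)-x}{n}$ (for any $x\in\mathbb R$) be its rotation number. **Theorem.** Let $\triangle PQR$ be a (non-degenerate) triangle with vertices in $D$ such that $d'(P,R)=d'(Q,R)$ and $d'(P,Q)>\log 9$. If $$\delta(P,Q,R)>\tfrac12\,\Delta_1'(P,Q),$$ then $\rho(\psi_{\triangle PQR})<\frac25$. -/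

import Mathlib

/-!  The plane is `ℂ`, the unit circle is Mathlib's `Circle`, and the disk is `Metric.ball (0 : ℂ) 1`. -/

open Filter Topology

noncomputable section

namespace BarBilliard

/-! ### The Beltrami-Klein model -/

/-- The open unit disk. -/
def disk : Set ℂ := Metric.ball 0 1

/-- Squared length of `Q - P`. -/
def coefA (P Q : ℂ) : ℝ := ‖Q - P‖ ^ 2

/-- The Euclidean inner product of `P` and `Q - P`. -/
def coefB (P Q : ℂ) : ℝ := inner ℝ P (Q - P)

/-- `‖P + s (Q - P)‖ = 1` reads `coefA * s ^ 2 + 2 * coefB * s + (‖P‖ ^ 2 - 1) = 0`; this is a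
quarter of the discriminant of that equation. -/
def disc (P Q : ℂ) : ℝ := coefB P Q ^ 2 - coefA P Q * (‖P‖ ^ 2 - 1)

/-- The point at infinity of the line `PQ` on the side of `P` (see `endpoints_eq`). -/
def endP (P Q : ℂ) : ℂ := P + (((-coefB P Q - √(disc P Q)) / coefA P Q : ℝ) : ℂ) * (Q - P)

/-- The point at infinity of the line `PQ` on the side of `Q` (see `endpoints_eq`). -/
def endQ (P Q : ℂ) : ℂ := P + (((-coefB P Q + √(disc P Q)) / coefA P Q : ℝ) : ℂ) * (Q - P)

/-- The distance `d'` of the Beltrami-Klein model, through the points at infinity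
`v₁ = endP P Q`, `v₂ = endQ P Q` of the line `PQ`. For `P = Q` the value is `0`. -/
def kleinDist (P Q : ℂ) : ℝ :=
  (1 / 2) * |Real.log ((dist (endP P Q) Q * dist (endQ P Q) P) /
    (dist (endP P Q) P * dist (endQ P Q) Q))|

/-- `Δ'_n(P, Q)`. -/
def Delta (n : ℕ) (P Q : ℂ) : ℝ :=
  Real.log ((Real.exp (n * kleinDist P Q) + 1) / (Real.exp (n * kleinDist P Q) - 1))

/-- `δ(P, Q, R)`: the least `d'(R, S)` over the points `S` of the hyperbolic line `PQ`. -/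
def delta (P Q R : ℂ) : ℝ :=
  sInf ((fun S => kleinDist R S) '' ((line[ℝ, P, Q] : Set ℂ) ∩ disk))

/-! ### The map `ψ_U` -/

/-- The gradient of the line `uv` in the coordinates given by the basis `{v, R(v)}`, where
`R(v) = i v` is `v` turned by a right angle: `(u - v) / v = a + b i` means
`u - v = a v + b R(v)`. -/
def lineGradient (u : ℂ) (v : Circle) : ℝ := ((u - v) / v).im / ((u - v) / v).re

/-- The least gradient of a line through `v` and a point of `U`. -/
def minGradient (U : Set ℂ) (v : Circle) : ℝ := sInf ((fun u => lineGradient u v) '' U)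

lemma ofReal_add_I_ne_zero (m : ℝ) : (m : ℂ) + Complex.I ≠ 0 := by
  intro h
  have := congrArg Complex.im h
  simp at this

/-- The point other than `v` in which the circle meets the line through `v` of gradient `m`,
namely `v (m - i) / (m + i)` (see `eq_secondPoint_iff`). -/
def secondPoint (v : Circle) (m : ℝ) : Circle :=
  v * Circle.ofConjDivSelf ((m : ℂ) + Complex.I) (ofReal_add_I_ne_zero m)

/-- `ψ_U(v)`: the point where the tangent from `v` to `U` that is first in counterclockwise
direction (the line of least gradient) meets the circle again. -/
def psi (U : Set ℂ) (v : Circle) : Circle := secondPoint v (minGradient U v)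

/-! ### Rotation number -/

/-- The projection `ℝ → ℝ / ℤ = S¹`. -/
def proj (x : ℝ) : Circle := Circle.exp (2 * Real.pi * x)

/-- `f` is the lift, with `f 0 ∈ [0, 1)`, of the orientation preserving homeomorphism `g`
of the circle. -/
structure IsNormalizedLift (g : Circle → Circle) (f : ℝ → ℝ) : Prop where
  continuous : Continuous f
  strictMono : StrictMono f
  map_add_one : ∀ x, f (x + 1) = f x + 1
  semiconj : ∀ x, proj (f x) = g (proj x)
  map_zero_mem : f 0 ∈ Set.Ico (0 : ℝ) 1

/-- `g` is an orientation preserving homeomorphism of the circle (it has a lift as above), and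
its rotation number is `ρ`. -/
def HasRotationNumber (g : Circle → Circle) (ρ : ℝ) : Prop :=
  ∃ f : ℝ → ℝ, IsNormalizedLift g f ∧
    ∀ x : ℝ, Tendsto (fun n : ℕ => (f^[n] x - x) / n) atTop (𝓝 ρ)

/-! ### The explicit formulas above are the intended objects -/

lemma eq_secondPoint_iff (v w : Circle) (m : ℝ) :
    w = secondPoint v m ↔ w ≠ v ∧ lineGradient w v = m := by
  have hv : (v : ℂ) ≠ 0 := Circle.coe_ne_zero v
  obtain ⟨z, hz⟩ : ∃ z : Circle, w = v * z := ⟨v⁻¹ * w, by simp⟩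
  subst hz
  have hquot : (((v * z : Circle) : ℂ) - v) / v = (z : ℂ) - 1 := by
    push_cast
    field_simp
  have hn : (z : ℂ).re ^ 2 + (z : ℂ).im ^ 2 = 1 := by
    have h := Circle.normSq_coe z
    rw [Complex.normSq_apply] at h
    linarith
  have hne : (v * z ≠ v) ↔ (z : ℂ).re - 1 ≠ 0 := by
    rw [not_iff_not, mul_eq_left]
    constructor
    · rintro rfl
      simp
    · intro h
      have h1 : (z : ℂ).re = 1 := by linarith
      have h2 : (z : ℂ).im = 0 := by
        rw [h1] at hn
        nlinarith
      exact Circle.ext (Complex.ext (by simpa using h1) (by simpa using h2))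
  have hI := ofReal_add_I_ne_zero m
  have hval : z = Circle.ofConjDivSelf ((m : ℂ) + Complex.I) hI ↔
      (z : ℂ) * (m + Complex.I) = m - Complex.I := by
    rw [← Circle.coe_inj, show ((Circle.ofConjDivSelf ((m : ℂ) + Complex.I) hI : Circle) : ℂ) =
      (starRingEnd ℂ) ((m : ℂ) + Complex.I) / ((m : ℂ) + Complex.I) from rfl, eq_div_iff hI]
    simp [sub_eq_add_neg]
  unfold secondPoint
  rw [mul_right_inj, hne, hval, lineGradient, hquot, Complex.ext_iff]
  simp only [Complex.mul_re, Complex.mul_im, Complex.add_re, Complex.add_im, Complex.sub_re,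
    Complex.sub_im, Complex.ofReal_re, Complex.ofReal_im, Complex.I_re, Complex.I_im,
    Complex.one_re, Complex.one_im]
  generalize (z : ℂ).re = a at *
  generalize (z : ℂ).im = b at *
  constructor
  · rintro ⟨h1, h2⟩
    have h3 : a - 1 ≠ 0 := by
      intro h
      have ha : a = 1 := by linarith
      subst ha
      have hb : b = 0 := by nlinarith
      subst hb
      linarith
    refine ⟨h3, ?_⟩
    rw [div_eq_iff h3]
    linarith
  · rintro ⟨h3, h⟩
    rw [div_eq_iff h3] at h
    have hb : b = m * (a - 1) := by linarith
    have hk : (a - 1) * (a + 1 + m ^ 2 * (a - 1)) = 0 := by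
      rw [hb] at hn
      linear_combination hn
    have hk2 := (mul_eq_zero.mp hk).resolve_left h3
    constructor
    · linarith
    · rw [hb]
      linear_combination hk2

lemma endpoints_eq {P Q : ℂ} (hP : P ∈ disk) (hPQ : P ≠ Q) :
    Metric.sphere (0 : ℂ) 1 ∩ line[ℝ, P, Q] = {endP P Q, endQ P Q} ∧ endP P Q ≠ endQ P Q := by
  have hne : Q - P ≠ 0 := sub_ne_zero.mpr (Ne.symm hPQ)
  have hA : 0 < coefA P Q := by
    unfold coefA
    positivity
  have hP1 : ‖P‖ ^ 2 < 1 := by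
    have h : ‖P‖ < 1 := by simpa [disk] using hP
    nlinarith [norm_nonneg P]
  have hD : 0 < disc P Q := by
    unfold disc
    nlinarith [sq_nonneg (coefB P Q)]
  have hs : √(disc P Q) ^ 2 = disc P Q := Real.sq_sqrt hD.le
  have hpos : 0 < √(disc P Q) := Real.sqrt_pos.mpr hD
  have hinj : ∀ s t : ℝ, P + (s : ℂ) * (Q - P) = P + (t : ℂ) * (Q - P) → s = t := by
    intro s t h
    exact_mod_cast mul_right_cancel₀ hne (add_left_cancel h)
  have hnorm : ∀ s : ℝ, ‖P + (s : ℂ) * (Q - P)‖ = 1 ↔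
      (s = (-coefB P Q - √(disc P Q)) / coefA P Q ∨
        s = (-coefB P Q + √(disc P Q)) / coefA P Q) := by
    intro s
    have h1 : ‖P + (s : ℂ) * (Q - P)‖ ^ 2 = ‖P‖ ^ 2 + 2 * (s * coefB P Q) + s ^ 2 * coefA P Q := by
      rw [← Complex.real_smul, norm_add_sq_real, norm_smul, real_inner_smul_right, mul_pow,
        Real.norm_eq_abs, sq_abs, coefA, coefB]
    have h2 : ‖P + (s : ℂ) * (Q - P)‖ = 1 ↔ ‖P + (s : ℂ) * (Q - P)‖ ^ 2 = 1 := by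
      exact (pow_eq_one_iff_of_nonneg (norm_nonneg _) two_ne_zero).symm
    have h3 : ‖P‖ ^ 2 + 2 * (s * coefB P Q) + s ^ 2 * coefA P Q = 1 ↔
        (s * coefA P Q - (-coefB P Q - √(disc P Q))) *
          (s * coefA P Q - (-coefB P Q + √(disc P Q))) = 0 := by
      have h4 : (s * coefA P Q - (-coefB P Q - √(disc P Q))) *
          (s * coefA P Q - (-coefB P Q + √(disc P Q))) =
          coefA P Q * (‖P‖ ^ 2 + 2 * (s * coefB P Q) + s ^ 2 * coefA P Q - 1) := by
        unfold disc at *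
        linear_combination -hs
      rw [h4, mul_eq_zero, or_iff_right hA.ne', sub_eq_zero]
    rw [h2, h1, h3, mul_eq_zero, sub_eq_zero, sub_eq_zero, eq_div_iff hA.ne', eq_div_iff hA.ne']
  constructor
  · ext z
    simp only [Set.mem_inter_iff, mem_sphere_zero_iff_norm, SetLike.mem_coe,
      Set.mem_insert_iff, Set.mem_singleton_iff]
    constructor
    · rintro ⟨hz, hl⟩
      obtain ⟨s, hs'⟩ := (vadd_left_mem_affineSpan_pair (k := ℝ) (p₁ := P) (p₂ := Q)
        (v := z - P)).mp (by simpa using hl)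
      have e : z = P + (s : ℂ) * (Q - P) := by
        have h6 : (s : ℂ) * (Q - P) = z - P := by simpa using hs'
        rw [h6]
        ring
      subst e
      rcases (hnorm s).mp hz with h | h
      · left
        rw [h, endP]
      · right
        rw [h, endQ]
    · have hmem : ∀ s : ℝ, P + (s : ℂ) * (Q - P) ∈ line[ℝ, P, Q] := by
        intro s
        have h7 := AffineMap.lineMap_mem_affineSpan_pair s P Q
        rwa [AffineMap.lineMap_apply, vsub_eq_sub, vadd_eq_add, add_comm,
          Complex.real_smul] at h7
      rintro (rfl | rfl)
      · exact ⟨(hnorm _).mpr (Or.inl rfl), hmem _⟩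
      · exact ⟨(hnorm _).mpr (Or.inr rfl), hmem _⟩
  · intro h
    have h5 := hinj _ _ h
    rw [div_left_inj' hA.ne'] at h5
    linarith

end BarBilliard

end

noncomputable section

namespace BarBilliard

open ComplexConjugate

/-! ### Lifting the involution of the circle through a point of the disk -/

/-! For `u` in the disk, `chordLift u` lifts the involution that exchanges the two ends of every
chord through `u`. The line of least gradient through a point of the circle can be taken through a
vertex of the triangle, so the minimum `triLift` of the three chord lifts is a lift F of `psi`.
Since F is continuous of degree one, it is enough to show F⁵x < x + 2 for every x
(`exists_rotationNumber_lt`).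

A projective automorphism of the disk and a rotation conjugate the chord lifts and bring the
triangle to P = -p, Q = p, R = hi (or with P and Q exchanged). Put k = (1 - p)/(1 + p) =
exp(-d'(P,Q)). Then d'(P,Q) > log 9 says k < 1/9. Half of Δ'₁(P,Q) is artanh k, while δ is at most
the distance artanh h from R to the midpoint of the base, so the height condition gives h > k.

For the critical apex ki the three involutions close up a pentagram. In the coordinate t of the
point (t - i)/(t + i) of the circle it is ∞ → -k → 1 → -1/k → 0 → ∞, which turns twice around. When
h > k, the point ki is interior to the triangle and F lies strictly below its chord lift
(`triLift_lt_of_interior`), so F carries no vertex of the pentagram beyond the next one. An orbit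
with F⁵x = x + 2 must then meet the arc 1 ≤ t < ∞ (`exists_mem_Ico_iterate_five_eq`). On that arc F⁵
is bounded by any word of five chord lifts. The pentagram itself at t = 1 and two words for t > 1
give F⁵x < x + 2 (`iterate_five_lt_of_involutions`); every word uses ki, which makes the bound
strict. -/

lemma mem_disk {u : ℂ} : u ∈ disk ↔ ‖u‖ < 1 := by simp [disk]

lemma proj_add (x y : ℝ) : proj (x + y) = proj x * proj y := by
  simp only [proj, mul_add, Circle.exp_add]

lemma proj_int (n : ℤ) : proj n = 1 :=
  Circle.exp_eq_one.mpr ⟨n, by ring⟩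

lemma proj_one : proj 1 = 1 := by simpa using proj_int 1

lemma proj_eq_proj_iff {x y : ℝ} : proj x = proj y ↔ ∃ n : ℤ, x = y + n := by
  unfold proj
  rw [Circle.exp_eq_exp]
  refine exists_congr fun n => ⟨fun h => ?_, fun h => by rw [h]; ring⟩
  have h2 : 2 * Real.pi * (x - (y + n)) = 0 := by linear_combination h
  have := (mul_eq_zero.mp h2).resolve_left (by positivity)
  linarith

lemma proj_surjective : Function.Surjective proj := by
  intro c
  refine ⟨Complex.arg c / (2 * Real.pi), ?_⟩
  rw [proj, mul_div_cancel₀ _ (by positivity), Circle.exp_arg]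

/-- Two reals with the same projection coincide if they lie in a common interval `(x, x + 1)`. -/
lemma eq_of_proj_eq {a b x : ℝ} (h : proj a = proj b) (ha : a ∈ Set.Ioo x (x + 1))
    (hb : b ∈ Set.Ioo x (x + 1)) : a = b := by
  obtain ⟨n, rfl⟩ := proj_eq_proj_iff.mp h
  have h1 : (n : ℝ) < 1 := by linarith [ha.2, hb.1]
  have h2 : (-1 : ℝ) < n := by linarith [ha.1, hb.2]
  have h3 : n < 1 := by exact_mod_cast h1
  have h4 : -1 < n := by exact_mod_cast h2
  have : n = 0 := by omega
  simp [this]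

/-- The factor whose argument measures the direction of `u` seen from the point `v` of the
circle. -/
def sight (u : ℂ) (v : Circle) : ℂ := 1 - conj u * v

lemma norm_conj_mul_coe (u : ℂ) (v : Circle) : ‖conj u * (v : ℂ)‖ = ‖u‖ := by
  rw [norm_mul, Circle.norm_coe, mul_one, RCLike.norm_conj]

lemma sight_re_pos {u : ℂ} (hu : u ∈ disk) (v : Circle) : 0 < (sight u v).re := by
  have h := Complex.re_le_norm (conj u * v)
  rw [norm_conj_mul_coe] at h
  have := mem_disk.mp hu
  simp only [sight, Complex.sub_re, Complex.one_re]
  linarith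

lemma sight_ne_zero {u : ℂ} (hu : u ∈ disk) (v : Circle) : sight u v ≠ 0 := by
  intro h
  have := sight_re_pos hu v
  simp [h] at this

/-- The lift, with displacement in `(0, 1)`, of the involution of the circle through `u`. -/
def chordLift (u : ℂ) (x : ℝ) : ℝ := x + 1 / 2 - Complex.arg (sight u (proj x)) / Real.pi

lemma chordLift_mem {u : ℂ} (hu : u ∈ disk) (x : ℝ) : chordLift u x ∈ Set.Ioo x (x + 1) := by
  have h := Complex.abs_arg_lt_pi_div_two_iff.mpr (Or.inl (sight_re_pos hu (proj x)))
  rw [abs_lt] at h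
  have hpi := Real.pi_pos
  have h1 : Complex.arg (sight u (proj x)) / Real.pi < 1 / 2 := by
    rw [div_lt_iff₀ hpi]
    linarith
  have h2 : -(1 / 2) < Complex.arg (sight u (proj x)) / Real.pi := by
    rw [lt_div_iff₀ hpi]
    linarith
  unfold chordLift
  constructor <;> linarith

lemma conj_mul_coe_mul (u : ℂ) (v : Circle) : (v : ℂ) * conj (sight u v) = v - u := by
  have : (v : ℂ) * conj (v : ℂ) = 1 := by simp [Complex.mul_conj]
  simp only [sight, map_sub, map_one, map_mul, Complex.conj_conj]
  linear_combination (-u) * this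

/-- With z = `sight u v`, the other end of the chord from v through u is (u - v)/z = -v · conj z /
z, and conj z / z = exp(-2i arg z). This is the origin of the formula for `chordLift`. -/
lemma proj_chordLift_mul (u : ℂ) (x : ℝ) :
    (proj (chordLift u x) : ℂ) * sight u (proj x) = u - proj x := by
  set z := sight u (proj x) with hz
  have hpi : (Real.pi : ℂ) ≠ 0 := by exact_mod_cast Real.pi_ne_zero
  have h1 : (proj (chordLift u x) : ℂ) = -proj x * Complex.exp (-(2 * z.arg * Complex.I)) := by
    rw [chordLift, ← hz]
    simp only [proj, Circle.coe_exp]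
    rw [← neg_one_mul, ← Complex.exp_pi_mul_I, ← Complex.exp_add, ← Complex.exp_add]
    congr 1
    push_cast
    field_simp
    ring
  have h2 : z = ‖z‖ * Complex.exp (z.arg * Complex.I) := (Complex.norm_mul_exp_arg_mul_I z).symm
  have h3 : conj z = ‖z‖ * Complex.exp (-(z.arg * Complex.I)) := by
    conv_lhs => rw [h2]
    rw [map_mul, Complex.conj_ofReal, ← Complex.exp_conj]
    simp
  have h4 : Complex.exp (-(2 * z.arg * Complex.I)) * z = conj z := by
    rw [h3]
    nth_rewrite 2 [h2]
    rw [mul_left_comm, ← Complex.exp_add]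
    congr 2
    ring
  have h5 := conj_mul_coe_mul u (proj x)
  rw [h1, mul_assoc, h4]
  linear_combination -h5

lemma proj_chordLift {u : ℂ} (hu : u ∈ disk) (x : ℝ) :
    (proj (chordLift u x) : ℂ) = (u - proj x) / sight u (proj x) := by
  rw [eq_div_iff (sight_ne_zero hu _), proj_chordLift_mul]

lemma proj_chordLift_eq {u : ℂ} (hu : u ∈ disk) {x : ℝ} {w : Circle}
    (h : (w : ℂ) * sight u (proj x) = u - proj x) : proj (chordLift u x) = w := by
  apply Circle.ext
  rw [proj_chordLift hu, ← h, mul_div_cancel_right₀ _ (sight_ne_zero hu _)]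

lemma chordLift_add_one (u : ℂ) (x : ℝ) : chordLift u (x + 1) = chordLift u x + 1 := by
  have : proj (x + 1) = proj x := by rw [proj_add, proj_one, mul_one]
  rw [chordLift, chordLift, this]
  ring

lemma continuous_proj : Continuous proj := by
  unfold proj
  fun_prop

lemma continuous_chordLift {u : ℂ} (hu : u ∈ disk) : Continuous (chordLift u) := by
  unfold chordLift
  refine (by fun_prop : Continuous fun x : ℝ => x + 1 / 2).sub (Continuous.div_const ?_ _)
  rw [continuous_iff_continuousAt]
  intro x
  have h1 : Continuous fun x => sight u (proj x) := by
    unfold sight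
    have := continuous_proj
    fun_prop
  exact (Complex.continuousAt_arg (Complex.mem_slitPlane_iff.mpr
    (Or.inl (sight_re_pos hu (proj x))))).comp_of_eq h1.continuousAt rfl

lemma chordLift_chordLift {u : ℂ} (hu : u ∈ disk) (x : ℝ) :
    chordLift u (chordLift u x) = x + 1 := by
  have hp : proj (chordLift u (chordLift u x)) = proj x := by
    apply proj_chordLift_eq hu
    -- The relation w(1 - ūv) = u - v is symmetric in v and w.
    have h := proj_chordLift_mul u x
    unfold sight at *
    linear_combination h
  obtain ⟨n, hn⟩ := proj_eq_proj_iff.mp hp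
  have h1 := chordLift_mem hu x
  have h2 := chordLift_mem hu (chordLift u x)
  rw [hn] at h2
  have h3 : (0 : ℝ) < n := by linarith [h1.1, h2.1]
  have h4 : (n : ℝ) < 2 := by linarith [h1.2, h2.2]
  have h5 : 0 < n := by exact_mod_cast h3
  have h6 : n < 2 := by exact_mod_cast h4
  have : n = 1 := by omega
  rw [hn, this]
  simp

lemma strictMono_chordLift {u : ℂ} (hu : u ∈ disk) : StrictMono (chordLift u) := by
  have hinj : Function.Injective (chordLift u) := by
    intro x y h
    have := congrArg (chordLift u) h
    rw [chordLift_chordLift hu, chordLift_chordLift hu] at this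
    linarith
  refine ((continuous_chordLift hu).strictMono_of_inj hinj).resolve_right fun h => ?_
  have h1 := h (show (0 : ℝ) < 0 + 1 by norm_num)
  rw [chordLift_add_one] at h1
  linarith

/-! ### The order of the chord lifts and the gradients -/

lemma lineGradient_eq (u : ℂ) (v : Circle) :
    lineGradient u v = -((sight u v).im / (sight u v).re) := by
  have hv : (v : ℂ) ≠ 0 := Circle.coe_ne_zero v
  have h : (u - v) / v = -conj (sight u v) := by
    rw [div_eq_iff hv]
    linear_combination conj_mul_coe_mul u v
  rw [lineGradient, h]
  simp [div_neg]

/-- The gradient is -tan of the argument of `sight`, and tan is increasing on the interval where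
that argument lies. -/
lemma chordLift_lt_iff {u w : ℂ} (hu : u ∈ disk) (hw : w ∈ disk) (x : ℝ) :
    chordLift u x < chordLift w x ↔ lineGradient u (proj x) < lineGradient w (proj x) := by
  have key : ∀ z : ℂ, 0 < z.re → z.arg ∈ Set.Ioo (-(Real.pi / 2)) (Real.pi / 2) := fun z hz =>
    abs_lt.mp (Complex.abs_arg_lt_pi_div_two_iff.mpr (Or.inl hz))
  rw [lineGradient_eq, lineGradient_eq, neg_lt_neg_iff, ← Complex.tan_arg, ← Complex.tan_arg,
    Real.strictMonoOn_tan.lt_iff_lt (key _ (sight_re_pos hw _)) (key _ (sight_re_pos hu _)),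
    chordLift, chordLift, sub_lt_sub_iff_left, div_lt_div_iff_of_pos_right Real.pi_pos]

lemma chordLift_le_iff {u w : ℂ} (hu : u ∈ disk) (hw : w ∈ disk) (x : ℝ) :
    chordLift u x ≤ chordLift w x ↔ lineGradient u (proj x) ≤ lineGradient w (proj x) := by
  rw [← not_lt, chordLift_lt_iff hw hu, not_lt]

lemma proj_chordLift_eq_secondPoint {u : ℂ} (hu : u ∈ disk) (x : ℝ) :
    proj (chordLift u x) = secondPoint (proj x) (lineGradient u (proj x)) := by
  rw [eq_secondPoint_iff]
  set v := proj x with hv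
  set w := proj (chordLift u x) with hw
  have h1 : w ≠ v := by
    intro h
    obtain ⟨n, hn⟩ := proj_eq_proj_iff.mp h
    have h1 := chordLift_mem hu x
    rw [hn] at h1
    have h3 : (0 : ℝ) < n := by linarith [h1.1]
    have h4 : (n : ℝ) < 1 := by linarith [h1.2]
    have h5 : 0 < n := by exact_mod_cast h3
    have h6 : n < 1 := by exact_mod_cast h4
    omega
  refine ⟨h1, ?_⟩
  have hz := sight_ne_zero hu v
  have hm : (w : ℂ) * sight u v = u - v := proj_chordLift_mul u x
  have hc := conj_mul_coe_mul u v
  -- That this product is real expresses that u, v, w are collinear.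
  have h2 : sight w v * conj (sight u v) = (2 * (sight u v).re : ℝ) := by
    have h3 : (v : ℂ) * conj (sight w v) * sight u v = v * (2 * (sight u v).re : ℝ) := by
      rw [conj_mul_coe_mul]
      have := Complex.add_conj (sight u v)
      push_cast at this ⊢
      linear_combination (-1) * hm + v * this - hc
    have h4 := mul_left_cancel₀ (Circle.coe_ne_zero v) ((mul_assoc _ _ _).symm.trans h3)
    have h5 := congrArg conj h4
    simpa only [map_mul, Complex.conj_conj, Complex.conj_ofReal] using h5
  have hr := sight_re_pos hu v
  have hre := congrArg Complex.re h2
  have him := congrArg Complex.im h2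
  simp only [Complex.mul_re, Complex.mul_im, Complex.conj_re, Complex.conj_im,
    Complex.ofReal_re, Complex.ofReal_im] at hre him
  rw [lineGradient_eq, lineGradient_eq, neg_inj]
  generalize (sight (w : ℂ) v).re = a at *
  generalize (sight (w : ℂ) v).im = b at *
  generalize (sight u v).re = c at *
  generalize (sight u v).im = d at *
  have ha : a ≠ 0 := by
    rintro rfl
    have : b * c = 0 := by linarith
    rcases mul_eq_zero.mp this with rfl | h
    · linarith
    · linarith
  rw [div_eq_div_iff ha hr.ne']
  linarith

/-! ### The lift of `psi` of a triangle -/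

/-- The lift of `psi` of the triangle `PQR`. -/
def triLift (P Q R : ℂ) (x : ℝ) : ℝ := min (chordLift P x) (min (chordLift Q x) (chordLift R x))

section triLift

variable {P Q R : ℂ}

lemma triLift_add_one (x : ℝ) : triLift P Q R (x + 1) = triLift P Q R x + 1 := by
  simp only [triLift, chordLift_add_one, min_add_add_right]

lemma triLift_strictMono (hP : P ∈ disk) (hQ : Q ∈ disk) (hR : R ∈ disk) :
    StrictMono (triLift P Q R) := fun _ _ h =>
  min_lt_min (strictMono_chordLift hP h)
    (min_lt_min (strictMono_chordLift hQ h) (strictMono_chordLift hR h))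

lemma continuous_triLift (hP : P ∈ disk) (hQ : Q ∈ disk) (hR : R ∈ disk) :
    Continuous (triLift P Q R) :=
  (continuous_chordLift hP).min ((continuous_chordLift hQ).min (continuous_chordLift hR))

lemma triLift_mem (hP : P ∈ disk) (hQ : Q ∈ disk) (hR : R ∈ disk) (x : ℝ) :
    triLift P Q R x ∈ Set.Ioo x (x + 1) :=
  ⟨lt_min (chordLift_mem hP x).1 (lt_min (chordLift_mem hQ x).1 (chordLift_mem hR x).1),
    (min_le_left _ _).trans_lt (chordLift_mem hP x).2⟩

lemma lineGradient_le_iff {w : ℂ} (hw : w ∈ disk) (v : Circle) (m : ℝ) :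
    m ≤ lineGradient w v ↔ (sight w v).im + m * (sight w v).re ≤ 0 := by
  have h := sight_re_pos hw v
  rw [lineGradient_eq, le_neg, div_le_iff₀ h]
  constructor <;> intro <;> linarith

/-- Points on the left of the directed line through `v` of gradient `m`. -/
lemma convex_setOf_le_lineGradient (v : Circle) (m : ℝ) :
    Convex ℝ {w : ℂ | w ∈ disk ∧ m ≤ lineGradient w v} := by
  intro a ha b hb s t hs ht hst
  have hd : s • a + t • b ∈ disk := convex_ball (0 : ℂ) 1 ha.1 hb.1 hs ht hst
  refine ⟨hd, ?_⟩
  have ha2 := (lineGradient_le_iff ha.1 v m).mp ha.2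
  have hb2 := (lineGradient_le_iff hb.1 v m).mp hb.2
  rw [lineGradient_le_iff hd]
  have h : sight (s • a + t • b) v = s * sight a v + t * sight b v := by
    have : (s : ℂ) + t = 1 := by exact_mod_cast hst
    simp only [sight, map_add, Complex.real_smul, map_mul, Complex.conj_ofReal]
    linear_combination -this
  rw [h]
  simp only [Complex.add_re, Complex.add_im, Complex.re_ofReal_mul, Complex.im_ofReal_mul]
  nlinarith

lemma exists_triLift_eq (x : ℝ) : ∃ u ∈ ({P, Q, R} : Set ℂ), triLift P Q R x = chordLift u x ∧
    ∀ w ∈ ({P, Q, R} : Set ℂ), chordLift u x ≤ chordLift w x := by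
  obtain ⟨u, hu, hmin⟩ := Set.exists_min_image ({P, Q, R} : Set ℂ) (fun u => chordLift u x)
    (Set.toFinite _) ⟨P, by simp⟩
  refine ⟨u, hu, le_antisymm ?_ ?_, hmin⟩
  · simp only [Set.mem_insert_iff, Set.mem_singleton_iff] at hu
    rcases hu with rfl | rfl | rfl <;> simp [triLift]
  · exact le_min (hmin P (by simp)) (le_min (hmin Q (by simp)) (hmin R (by simp)))

lemma proj_triLift (hP : P ∈ disk) (hQ : Q ∈ disk) (hR : R ∈ disk) (x : ℝ) :
    proj (triLift P Q R x) = psi (convexHull ℝ {P, Q, R}) (proj x) := by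
  obtain ⟨u, hu, he, hmin⟩ := exists_triLift_eq (P := P) (Q := Q) (R := R) x
  have hdisk : ({P, Q, R} : Set ℂ) ⊆ disk := by
    rintro w (rfl | rfl | rfl) <;> assumption
  rw [he, proj_chordLift_eq_secondPoint (hdisk hu), psi, minGradient]
  congr 1
  have hl : IsLeast ((fun u => lineGradient u (proj x)) '' convexHull ℝ {P, Q, R})
      (lineGradient u (proj x)) := by
    refine ⟨⟨u, subset_convexHull ℝ _ hu, rfl⟩, ?_⟩
    rintro _ ⟨w, hw, rfl⟩
    have hsub : convexHull ℝ {P, Q, R} ⊆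
        {w : ℂ | w ∈ disk ∧ lineGradient u (proj x) ≤ lineGradient w (proj x)} :=
      convexHull_min (fun w hw => ⟨hdisk hw,
        (chordLift_le_iff (hdisk hu) (hdisk hw) x).mp (hmin w hw)⟩)
        (convex_setOf_le_lineGradient _ _)
    exact (hsub hw).2
  exact hl.csInf_eq.symm

lemma isNormalizedLift_triLift (hP : P ∈ disk) (hQ : Q ∈ disk) (hR : R ∈ disk) :
    IsNormalizedLift (psi (convexHull ℝ {P, Q, R})) (triLift P Q R) where
  continuous := continuous_triLift hP hQ hR
  strictMono := triLift_strictMono hP hQ hR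
  map_add_one := triLift_add_one
  semiconj := proj_triLift hP hQ hR
  map_zero_mem := by
    have := triLift_mem hP hQ hR 0
    exact ⟨this.1.le, by linarith [this.2]⟩

lemma exists_rotationNumber_lt (hP : P ∈ disk) (hQ : Q ∈ disk) (hR : R ∈ disk)
    (h : ∀ x, (triLift P Q R)^[5] x < x + 2) :
    ∃ ρ : ℝ, HasRotationNumber (psi (convexHull ℝ {P, Q, R})) ρ ∧ ρ < 2 / 5 := by
  let F : CircleDeg1Lift :=
    ⟨⟨triLift P Q R, (triLift_strictMono hP hQ hR).monotone⟩, triLift_add_one⟩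
  have hF : Continuous F := continuous_triLift hP hQ hR
  refine ⟨F.translationNumber, ⟨triLift P Q R, isNormalizedLift_triLift hP hQ hR, fun x => ?_⟩, ?_⟩
  · have := F.tendsto_translationNumber x
    simp only [CircleDeg1Lift.coe_pow] at this
    exact this
  · have h5 := (F ^ 5).translationNumber_lt_of_forall_lt_add (F.continuous_pow hF 5) (z := 2)
      (fun x => by rw [CircleDeg1Lift.coe_pow]; exact h x)
    rw [F.translationNumber_pow] at h5
    push_cast at h5
    linarith

end triLift

/-! ### A real coordinate on the circle -/

/-- The point of `(0, 1)` that is projected to the point `(t - i) / (t + i)` of the circle. -/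
def cayley (t : ℝ) : ℝ := 1 / 2 + Real.arctan t / Real.pi

lemma cayley_strictMono : StrictMono cayley := fun _ _ h => by
  unfold cayley
  have := div_lt_div_of_pos_right (Real.arctan_strictMono h) Real.pi_pos
  linarith

lemma cayley_mem (t : ℝ) : cayley t ∈ Set.Ioo (0 : ℝ) 1 := by
  have hpi := Real.pi_pos
  have h1 : Real.arctan t / Real.pi < 1 / 2 := by
    rw [div_lt_iff₀ hpi]
    linarith [Real.arctan_lt_pi_div_two t]
  have h2 : -(1 / 2) < Real.arctan t / Real.pi := by
    rw [lt_div_iff₀ hpi]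
    linarith [Real.neg_pi_div_two_lt_arctan t]
  unfold cayley
  constructor <;> linarith

lemma exists_cayley_eq {x : ℝ} (hx : x ∈ Set.Ioo (0 : ℝ) 1) : ∃ t, cayley t = x := by
  have hpi := Real.pi_pos
  refine ⟨Real.tan (Real.pi * (x - 1 / 2)), ?_⟩
  rw [cayley, Real.arctan_tan (by nlinarith [hx.1]) (by nlinarith [hx.2])]
  field_simp
  ring

lemma proj_cayley_mul (t : ℝ) :
    (proj (cayley t) : ℂ) * (t + Complex.I) = t - Complex.I := by
  set θ := Real.arctan t with hθ
  have hc : Real.cos θ ≠ 0 := (Real.cos_arctan_pos t).ne'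
  have ht : t * Real.cos θ = Real.sin θ := by
    rw [← Real.tan_arctan t, ← hθ, Real.tan_eq_sin_div_cos, div_mul_cancel₀ _ hc]
  have h1 : (proj (cayley t) : ℂ) = -Complex.exp (θ * Complex.I) ^ 2 := by
    have hpi : (Real.pi : ℂ) ≠ 0 := by exact_mod_cast Real.pi_ne_zero
    rw [cayley, ← hθ]
    simp only [proj, Circle.coe_exp]
    rw [← Complex.exp_nat_mul, ← neg_one_mul, ← Complex.exp_pi_mul_I, ← Complex.exp_add]
    congr 1
    push_cast
    field_simp
  have hc' : (Real.cos θ : ℂ) ≠ 0 := by exact_mod_cast hc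
  have ht' : (t : ℂ) * Real.cos θ = Real.sin θ := by exact_mod_cast ht
  have hcs : (Real.sin θ : ℂ) ^ 2 + (Real.cos θ : ℂ) ^ 2 = 1 := by
    exact_mod_cast Real.sin_sq_add_cos_sq θ
  apply mul_right_cancel₀ hc'
  rw [h1, Complex.exp_mul_I, ← Complex.ofReal_cos, ← Complex.ofReal_sin, mul_assoc, add_mul,
    sub_mul, ht']
  generalize (Real.sin θ : ℂ) = s at *
  generalize (Real.cos θ : ℂ) = c at *
  have hI := Complex.I_sq
  have he : (c + s * Complex.I) * (s + Complex.I * c) = Complex.I := by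
    linear_combination Complex.I * hcs + c * s * hI
  linear_combination -(c + s * Complex.I) * he - s * hI

/-- The chord through the points with coordinates `s` and `t` contains `u`. -/
lemma proj_chordLift_eq_of_cayley {u : ℂ} (hu : u ∈ disk) {s t : ℝ}
    (h : u * (s + Complex.I) * (t + Complex.I) + conj u * (s - Complex.I) * (t - Complex.I) =
      2 * (s * t + 1)) : proj (chordLift u (cayley t)) = proj (cayley s) := by
  apply proj_chordLift_eq hu
  apply mul_right_cancel₀ (ofReal_add_I_ne_zero s)
  apply mul_right_cancel₀ (ofReal_add_I_ne_zero t)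
  have hs := proj_cayley_mul s
  have ht := proj_cayley_mul t
  unfold sight
  have hI := Complex.I_sq
  linear_combination (t + Complex.I) * hs - conj u * (proj (cayley s)) * (s + Complex.I) * ht -
    conj u * (t - Complex.I) * hs + (s + Complex.I) * ht - h - 2 * hI

/-- If the involution through `u` sends the point with coordinate `t` to that with coordinate
`s > t`, then it does so without passing through `1`. -/
lemma chordLift_cayley_of_lt {u : ℂ} (hu : u ∈ disk) {s t : ℝ}
    (h : u * (s + Complex.I) * (t + Complex.I) + conj u * (s - Complex.I) * (t - Complex.I) =
      2 * (s * t + 1)) (hst : t < s) : chordLift u (cayley t) = cayley s := by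
  refine eq_of_proj_eq (x := cayley t) (proj_chordLift_eq_of_cayley hu h)
    (chordLift_mem hu _) ⟨cayley_strictMono hst, ?_⟩
  linarith [(cayley_mem t).1, (cayley_mem s).2]

lemma chordLift_cayley_of_gt {u : ℂ} (hu : u ∈ disk) {s t : ℝ}
    (h : u * (s + Complex.I) * (t + Complex.I) + conj u * (s - Complex.I) * (t - Complex.I) =
      2 * (s * t + 1)) (hst : s < t) : chordLift u (cayley t) = cayley s + 1 := by
  refine eq_of_proj_eq (x := cayley t) ?_ (chordLift_mem hu _)
    ⟨by linarith [(cayley_mem t).2, (cayley_mem s).1], by linarith [cayley_strictMono hst]⟩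
  rw [proj_add, proj_one, mul_one]
  exact proj_chordLift_eq_of_cayley hu h

/-! ### Degree one maps of the line with a partial pentagram orbit -/

section DegreeOne

variable {F : ℝ → ℝ}

lemma map_add_natCast_of_map_add_one (h1 : ∀ x, F (x + 1) = F x + 1) (x : ℝ) (n : ℕ) :
    F (x + n) = F x + n := by
  induction n with
  | zero => simp
  | succ n ih =>
    push_cast
    rw [← add_assoc, h1, ih, add_assoc]

lemma map_sub_intCast_of_map_add_one (h1 : ∀ x, F (x + 1) = F x + 1) (x : ℝ) (n : ℤ) :
    F (x - n) = F x - n := by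
  obtain ⟨n, rfl | rfl⟩ := n.eq_nat_or_neg
  · have := map_add_natCast_of_map_add_one h1 (x - n) n
    rw [sub_add_cancel] at this
    push_cast
    linarith
  · have := map_add_natCast_of_map_add_one h1 x n
    push_cast
    rw [sub_neg_eq_add, sub_neg_eq_add, this]

/-- If `F` moves the five points `e₀ < ⋯ < e₄` of a fundamental domain at most two places
forward, then an orbit of rotation number `2 / 5` visits `[e₄, e₀ + 1)`. -/
lemma exists_mem_Ico_iterate_five_eq (hF : StrictMono F) (h1 : ∀ x, F (x + 1) = F x + 1)
    {e₀ e₁ e₂ e₃ e₄ : ℝ} (he₀ : F e₀ ≤ e₂) (he₁ : F e₁ ≤ e₃) (he₂ : F e₂ ≤ e₄)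
    (he₃ : F e₃ ≤ e₀ + 1) (he₄ : F e₄ ≤ e₁ + 1) {x : ℝ} (hx : F^[5] x = x + 2) :
    ∃ y ∈ Set.Ico e₄ (e₀ + 1), F^[5] y = y + 2 := by
  by_contra! hcon
  have h2 : ∀ x, F (x + 2) = F x + 2 := fun x => by
    have := map_add_natCast_of_map_add_one h1 x 2
    exact_mod_cast this
  have hS : ∀ y, F^[5] y = y + 2 → F^[5] (F y) = F y + 2 := fun y hy => by
    rw [← Function.iterate_succ_apply, Function.iterate_succ_apply', hy, h2]
  have hshift : ∀ y (n : ℤ), F^[5] y = y + 2 → F^[5] (y - n) = y - n + 2 := fun y n hy => by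
    simp only [Function.iterate_succ, Function.iterate_zero, Function.comp_apply, id_eq,
      map_sub_intCast_of_map_add_one h1] at hy ⊢
    rw [hy]
    ring
  -- An orbit point that is before `e₀ + 1 + n` but outside the forbidden arc is already before `e₄
  -- + n`. This gains one place of the pentagram. In each case below x lies between two consecutive
  -- marks; five steps from the later mark, less the gained place, end before the earlier mark plus
  -- 2.
  have avoid : ∀ y (n : ℤ), F^[5] y = y + 2 → y < e₀ + 1 + n → y < e₄ + n := by
    intro y n hy hlt
    by_contra! hle
    exact hcon (y - n) ⟨by linarith, by linarith⟩ (hshift y n hy)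
  have step : ∀ {y a b : ℝ} (n : ℤ), F a ≤ b → y < a + n → F y < b + n := by
    intro y a b n hab hy
    have h3 := hF hy
    have h4 := map_sub_intCast_of_map_add_one h1 a (-n)
    push_cast at h4
    rw [sub_neg_eq_add, sub_neg_eq_add] at h4
    linarith
  obtain ⟨x, hx, hx0, hx1⟩ : ∃ x, F^[5] x = x + 2 ∧ e₀ ≤ x ∧ x < e₀ + 1 := by
    refine ⟨x - ⌊x - e₀⌋, hshift x _ hx, ?_, ?_⟩
    · linarith [Int.floor_le (x - e₀)]
    · linarith [Int.lt_floor_add_one (x - e₀)]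
  have s1 := hS _ hx
  have s2 := hS _ s1
  have s3 := hS _ s2
  have s4 := hS _ s3
  have hx5 : F (F (F (F (F x)))) = x + 2 := hx
  have hx4 : x < e₄ := by simpa using avoid x 0 hx (by simpa using hx1)
  rcases lt_or_ge x e₁ with h | h
  · have a1 := step 0 he₁ (by simpa using h)
    have a2 := step 0 he₃ a1
    have a3 := avoid _ 0 s2 a2
    have a4 := step 0 he₄ a3
    have a5 := step 1 he₁ (by simpa using a4)
    have a6 := step 1 he₃ a5
    push_cast at a6
    linarith
  rcases lt_or_ge x e₂ with h | h
  · have a1 := step 0 he₂ (by simpa using h)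
    have a2 := step 0 he₄ a1
    have a3 := step 1 he₁ (by simpa using a2)
    have a4 := step 1 he₃ a3
    have a5 := avoid _ 1 s4 a4
    have a6 := step 1 he₄ a5
    push_cast at a6
    linarith
  rcases lt_or_ge x e₃ with h' | h'
  · have a1 := step 0 he₃ (by simpa using h')
    have a2 := avoid _ 0 s1 a1
    have a3 := step 0 he₄ a2
    have a4 := step 1 he₁ (by simpa using a3)
    have a5 := step 1 he₃ a4
    have a6 := step 2 he₀ (y := F (F (F (F x)))) (by push_cast at a5 ⊢; linarith)
    push_cast at a6
    linarith
  · have a1 := step 0 he₄ (by simpa using hx4)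
    have a2 := step 1 he₁ (by simpa using a1)
    have a3 := step 1 he₃ a2
    have a4 := avoid _ 1 s3 a3
    have a5 := step 1 he₄ a4
    have a6 := step 2 he₁ (y := F (F (F (F x)))) (by push_cast at a5 ⊢; linarith)
    push_cast at a6
    linarith

/-- The displacement of F⁵ is below 2 at `e₄`. If it reached 2 anywhere it would equal 2 at some
point, and the orbit of that point would visit the excluded arc. -/
lemma iterate_five_lt_of_partial_pentagram (hF : StrictMono F) (hc : Continuous F)
    (h1 : ∀ x, F (x + 1) = F x + 1) {e₀ e₁ e₂ e₃ e₄ : ℝ} (he₀ : F e₀ ≤ e₂) (he₁ : F e₁ ≤ e₃)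
    (he₂ : F e₂ ≤ e₄) (he₃ : F e₃ ≤ e₀ + 1) (he₄ : F e₄ ≤ e₁ + 1) (hlt : e₄ < e₀ + 1)
    (h : ∀ y ∈ Set.Ico e₄ (e₀ + 1), F^[5] y < y + 2) (x : ℝ) : F^[5] x < x + 2 := by
  by_contra! hx
  have hcont : Continuous fun y => F^[5] y - y := (hc.iterate 5).sub continuous_id
  obtain ⟨y, hy⟩ : ∃ y, F^[5] y - y = 2 := by
    have h4 := h e₄ ⟨le_rfl, hlt⟩
    exact mem_range_of_exists_le_of_exists_ge hcont ⟨e₄, by linarith⟩ ⟨x, by linarith⟩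
  obtain ⟨z, hz, hz2⟩ := exists_mem_Ico_iterate_five_eq hF h1 he₀ he₁ he₂ he₃ he₄
    (x := y) (by linarith)
  exact (h z hz).ne hz2

end DegreeOne

/-! ### The triangle in normal position -/

section Normal

variable {k : ℝ}

lemma ofReal_mem_disk {r : ℝ} : (r : ℂ) ∈ disk ↔ |r| < 1 := by
  rw [mem_disk, Complex.norm_real, Real.norm_eq_abs]

lemma ofReal_mul_I_mem_disk {r : ℝ} : (r : ℂ) * Complex.I ∈ disk ↔ |r| < 1 := by
  rw [mem_disk, norm_mul, Complex.norm_I, mul_one, Complex.norm_real, Real.norm_eq_abs]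

/-- Otherwise an affine functional that vanishes at the interior point ki is nonpositive at all
three vertices, hence vanishes identically. Its coefficients then force `proj x = 0`, which is not
on the circle. -/
lemma triLift_lt_of_interior {p h k : ℝ} (hp : 0 < p) (hp1 : p < 1) (hk : 0 < k) (hkh : k < h)
    (hh1 : h < 1) (x : ℝ) :
    triLift (-(p : ℂ)) p (h * Complex.I) x < chordLift (k * Complex.I) x := by
  have hPd : -(p : ℂ) ∈ disk := by
    rw [← Complex.ofReal_neg, ofReal_mem_disk, abs_neg, abs_of_pos hp]
    exact hp1
  have hQd : (p : ℂ) ∈ disk := by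
    rw [ofReal_mem_disk, abs_of_pos hp]
    exact hp1
  have hRd : (h : ℂ) * Complex.I ∈ disk := by
    rw [ofReal_mul_I_mem_disk, abs_of_pos (hk.trans hkh)]
    exact hh1
  have hSd : (k : ℂ) * Complex.I ∈ disk := by
    rw [ofReal_mul_I_mem_disk, abs_of_pos hk]
    linarith
  by_contra! hle
  have h1 := le_min_iff.mp hle
  have h2 := le_min_iff.mp h1.2
  obtain ⟨m, hm⟩ : ∃ m, m = lineGradient (k * Complex.I) (proj x) := ⟨_, rfl⟩
  have gP := (chordLift_le_iff hSd hPd x).mp h1.1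
  have gQ := (chordLift_le_iff hSd hQd x).mp h2.1
  have gR := (chordLift_le_iff hSd hRd x).mp h2.2
  rw [← hm, lineGradient_le_iff hPd] at gP
  rw [← hm, lineGradient_le_iff hQd] at gQ
  rw [← hm, lineGradient_le_iff hRd] at gR
  have gS : (sight (k * Complex.I) (proj x)).im + m * (sight (k * Complex.I) (proj x)).re = 0 := by
    have := (sight_re_pos hSd (proj x)).ne'
    rw [hm, lineGradient_eq]
    field_simp
    ring
  have hn : (proj x : ℂ).re ^ 2 + (proj x : ℂ).im ^ 2 = 1 := by
    have h := Circle.normSq_coe (proj x)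
    rw [Complex.normSq_apply] at h
    linarith
  simp only [sight, Complex.sub_re, Complex.sub_im, Complex.mul_re, Complex.mul_im,
    Complex.one_re, Complex.one_im, Complex.conj_re, Complex.conj_im, Complex.neg_re,
    Complex.neg_im, Complex.ofReal_re, Complex.ofReal_im, Complex.I_re, Complex.I_im] at gP gQ gR gS
  generalize (proj x : ℂ).re = c at *
  generalize (proj x : ℂ).im = s at *
  ring_nf at gP gQ gR gS
  -- The sum of the conditions at ±p is the condition at 0; next, ki is a convex combination of 0
  -- and hi.
  have hm0 : m ≤ 0 := by linarith
  have hm1 : k * (m - m * s * h + c * h) + (h - k) * m = 0 := by linear_combination h * gS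
  have hk' : k * (m - m * s * h + c * h) ≤ 0 :=
    mul_nonpos_of_nonneg_of_nonpos hk.le (by linarith)
  have hm2 : m = 0 := by nlinarith
  subst hm2
  have hs : s = 0 := by nlinarith
  have hc : c = 0 := by
    have : k * c = 0 := by linarith
    exact (mul_eq_zero.mp this).resolve_left hk.ne'
  subst hs hc
  norm_num at hn

/-- At u = -p the chord equation reads (1 + p)st = -(1 - p), and `hpk` says k = (1 - p)/(1 + p). -/
lemma involution_left {p : ℝ} (hpk : p * (1 + k) = 1 - k) {s t : ℝ}
    (h : s * t = -k) :
    -(p : ℂ) * (s + Complex.I) * (t + Complex.I) + conj (-(p : ℂ)) * (s - Complex.I) *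
      (t - Complex.I) = 2 * (s * t + 1) := by
  have h' : (s : ℂ) * t = -k := by exact_mod_cast h
  have hpk' : (p : ℂ) * (1 + k) = 1 - k := by exact_mod_cast hpk
  simp only [map_neg, Complex.conj_ofReal]
  linear_combination (-2 * p - 2) * h' + 2 * hpk' - 2 * p * Complex.I_sq

lemma involution_right {p : ℝ} (hpk : p * (1 + k) = 1 - k) (hk : 0 < k) {s t : ℝ}
    (h : s * t * k = -1) :
    (p : ℂ) * (s + Complex.I) * (t + Complex.I) + conj (p : ℂ) * (s - Complex.I) *
      (t - Complex.I) = 2 * (s * t + 1) := by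
  have h' : (s : ℂ) * t * k = -1 := by exact_mod_cast h
  have hpk' : (p : ℂ) * (1 + k) = 1 - k := by exact_mod_cast hpk
  have hk' : (k : ℂ) ≠ 0 := by exact_mod_cast hk.ne'
  simp only [Complex.conj_ofReal]
  apply mul_right_cancel₀ hk'
  linear_combination (2 * p - 2) * h' - 2 * hpk' + 2 * p * k * Complex.I_sq

lemma involution_top {s t : ℝ} (h : s * t + k * (s + t) + 1 = 0) :
    (k * Complex.I : ℂ) * (s + Complex.I) * (t + Complex.I) + conj (k * Complex.I : ℂ) *
      (s - Complex.I) * (t - Complex.I) = 2 * (s * t + 1) := by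
  have h' : (s : ℂ) * t + k * (s + t) + 1 = 0 := by exact_mod_cast h
  simp only [map_mul, Complex.conj_ofReal, Complex.conj_I]
  linear_combination (-2) * h' + 2 * k * (s + t) * Complex.I_sq

/-- The coordinate t = ∞ is the point 1 of the circle, with lifts the integers; it is not a value of
`cayley` and is treated apart. -/
lemma chordLift_mul_I_zero (hk : 0 < k) (hk1 : k < 1) :
    chordLift (k * Complex.I) 0 = cayley (-k) := by
  have hd : (k : ℂ) * Complex.I ∈ disk := by
    rw [ofReal_mul_I_mem_disk, abs_of_pos hk]
    exact hk1
  have h0 : proj 0 = 1 := by simpa using proj_int 0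
  have hc := cayley_mem (-k)
  refine eq_of_proj_eq (x := 0) (proj_chordLift_eq hd ?_) (chordLift_mem hd 0)
    ⟨hc.1, by linarith [hc.2]⟩
  have := proj_cayley_mul (-k)
  apply mul_right_cancel₀ Complex.I_ne_zero
  rw [sight, h0]
  push_cast at this ⊢
  simp only [map_mul, Complex.conj_ofReal, Complex.conj_I]
  linear_combination this + (proj (cayley (-k)) * k - k) * Complex.I_sq

lemma chordLift_ofReal_cayley_zero {p : ℝ} (hp : (p : ℂ) ∈ disk) :
    chordLift p (cayley 0) = 1 := by
  have h := proj_cayley_mul 0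
  have h0 : (proj (cayley 0) : ℂ) = -1 := by
    apply mul_right_cancel₀ Complex.I_ne_zero
    push_cast at h
    linear_combination h
  have hc := cayley_mem 0
  refine eq_of_proj_eq (x := cayley 0) (proj_chordLift_eq hp ?_) (chordLift_mem hp _)
    ⟨hc.2, by linarith [hc.1]⟩
  rw [sight, h0, proj_one, Complex.conj_ofReal]
  simp
  ring

end Normal

/-! ### Bounds by words of five involutions -/

section Words

variable {F : ℝ → ℝ}

lemma map_le_of_le_cayley (hF : StrictMono F) (h1 : ∀ x, F (x + 1) = F x + 1) {y t a : ℝ} {n : ℕ}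
    (hy : y ≤ cayley t + n) (h : F (cayley t) ≤ a) : F y ≤ a + n := by
  have h3 := hF.monotone hy
  rw [map_add_natCast_of_map_add_one h1] at h3
  linarith

lemma map_lt_of_lt_cayley (hF : StrictMono F) (h1 : ∀ x, F (x + 1) = F x + 1) {y t a : ℝ} {n : ℕ}
    (hy : y < cayley t + n) (h : F (cayley t) ≤ a) : F y < a + n := by
  have h3 := hF hy
  rw [map_add_natCast_of_map_add_one h1] at h3
  linarith

lemma map_lt_of_le_cayley (hF : StrictMono F) (h1 : ∀ x, F (x + 1) = F x + 1) {y t a : ℝ} {n : ℕ}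
    (hy : y ≤ cayley t + n) (h : F (cayley t) < a) : F y < a + n := by
  have h3 := hF.monotone hy
  rw [map_add_natCast_of_map_add_one h1] at h3
  linarith

/-- A degree one map below the three involutions `t ↦ -k / t`, `t ↦ -1 / (k t)` and
`t ↦ -(k t + 1) / (t + k)` turns points less than twice in five steps. -/
lemma iterate_five_lt_of_involutions {k : ℝ} (hk : 0 < k) (hk9 : k < 1 / 9) (hF : StrictMono F)
    (hc : Continuous F) (h1 : ∀ x, F (x + 1) = F x + 1)
    (hP : ∀ s t, s * t = -k → t < s → F (cayley t) ≤ cayley s)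
    (hQ : ∀ s t, s * t * k = -1 → s < t → F (cayley t) ≤ cayley s + 1)
    (hR : ∀ s t, s * t + k * (s + t) + 1 = 0 → t < s → F (cayley t) < cayley s)
    (hR' : ∀ s t, s * t + k * (s + t) + 1 = 0 → s < t → F (cayley t) < cayley s + 1)
    (h0 : F (cayley 0) ≤ 1) (hinf : F 0 < cayley (-k)) (x : ℝ) : F^[5] x < x + 2 := by
  -- The pentagram in cyclic order is ∞, -1/k, -k, 0, 1; each vertex goes at most two places
  -- forward.
  have e1 : F (cayley (-(1 / k))) < cayley 0 :=
    hR _ _ (by field_simp; ring) (by have : 0 < 1 / k := by positivity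
                                     linarith)
  have e2 : F (cayley (-k)) ≤ cayley 1 := hP _ _ (by ring) (by linarith)
  have e4 : F (cayley 1) ≤ cayley (-(1 / k)) + 1 :=
    hQ _ _ (by field_simp) (by have : 0 < 1 / k := by positivity
                               linarith)
  refine iterate_five_lt_of_partial_pentagram (e₀ := 0) (e₁ := cayley (-(1 / k)))
    (e₂ := cayley (-k)) (e₃ := cayley 0) (e₄ := cayley 1) hF hc h1 hinf.le e1.le e2
    (by linarith) e4 (by linarith [(cayley_mem 1).2]) ?_ x
  rintro y ⟨hy, hy1⟩
  obtain ⟨t, rfl⟩ := exists_cayley_eq (x := y) ⟨by linarith [(cayley_mem 1).1], by linarith⟩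
  have ht : 1 ≤ t := cayley_strictMono.le_iff_le.mp hy
  change F (F (F (F (F (cayley t))))) < cayley t + 2
  rcases ht.eq_or_lt with rfl | ht
  · -- the pentagram itself
    have s2 : F (F (cayley 1)) < cayley 0 + (1 : ℕ) :=
      map_lt_of_le_cayley hF h1 (by simpa using e4) e1
    have s3 := map_lt_of_lt_cayley hF h1 s2 h0
    have s4 := hF s3
    have h2 := map_add_natCast_of_map_add_one h1 0 2
    have s4' : F (F (F (F (cayley 1)))) < cayley (-k) + (2 : ℕ) := by
      push_cast at *
      norm_num at s4 h2
      linarith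
    have s5 := map_lt_of_lt_cayley hF h1 s4' e2
    exact_mod_cast s5
  have hk2 : k ^ 2 < 1 / 81 := by nlinarith
  -- The word `PRQRQ` sends t to (1 - k + k² - k²t)/(1 - kt). This is at most t exactly when (t -
  -- 1)(1 - k + k² - kt) ≥ 0, given kt < 1, which explains the threshold. Words are read from right
  -- to left.
  rcases le_or_gt (k * t) (1 - k + k ^ 2) with hle | hgt
  · -- the word `PRQRQ`
    have ha : 0 < t - 1 := by linarith
    have hd : 0 < 1 - k ^ 2 * t := by nlinarith
    have hb : 0 < 1 - k * t := by nlinarith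
    have hg : 0 < 1 - k + k ^ 2 - k ^ 2 * t := by nlinarith
    have t0 : 0 < t := by linarith
    have n1 : -(1 / (k * t)) < 0 := by
      have : 0 < 1 / (k * t) := by positivity
      linarith
    have p2 : 0 < k * (t - 1) / (1 - k ^ 2 * t) := by positivity
    have n3 : -((1 - k ^ 2 * t) / (k ^ 2 * (t - 1))) < 0 := by
      have : 0 < (1 - k ^ 2 * t) / (k ^ 2 * (t - 1)) := by positivity
      linarith
    -- The fourth step stays among negative coordinates. This order shows that it does not pass ∞,
    -- so that only the two steps by Q add a turn.
    have lt34 : -((1 - k ^ 2 * t) / (k ^ 2 * (t - 1))) <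
        -(k * (1 - k * t) / (1 - k + k ^ 2 - k ^ 2 * t)) := by
      rw [neg_lt_neg_iff, div_lt_div_iff₀ hg (by positivity)]
      have hgk : 1 - k ^ 2 * t = (1 - k + k ^ 2 - k ^ 2 * t) + k * (1 - k) := by ring
      nlinarith [mul_pos (mul_pos hk hg) (sub_pos.mpr ht), mul_pos hg hd,
        mul_pos hk (mul_pos hg hd), mul_pos (pow_pos hk 3) (mul_pos ha hb)]
    have p5 : 0 < (1 - k + k ^ 2 - k ^ 2 * t) / (1 - k * t) := by positivity
    have n4 : -(k * (1 - k * t) / (1 - k + k ^ 2 - k ^ 2 * t)) < 0 := by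
      have : 0 < k * (1 - k * t) / (1 - k + k ^ 2 - k ^ 2 * t) := by positivity
      linarith
    have s1 : F (cayley t) ≤ cayley (-(1 / (k * t))) + (1 : ℕ) := by
      simpa using hQ _ _ (by field_simp) (n1.trans t0)
    have s2 := map_le_of_le_cayley hF h1 s1
      (hR (k * (t - 1) / (1 - k ^ 2 * t)) _ (by field_simp; ring) (n1.trans p2)).le
    have s3 := map_le_of_le_cayley hF h1 s2
      (hQ (-((1 - k ^ 2 * t) / (k ^ 2 * (t - 1)))) _ (by field_simp) (n3.trans p2))
    have s4 := map_lt_of_le_cayley hF h1 (y := F (F (F (cayley t)))) (n := 2)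
      (by push_cast at s3 ⊢; linarith)
      (hR (-(k * (1 - k * t) / (1 - k + k ^ 2 - k ^ 2 * t)))
        (-((1 - k ^ 2 * t) / (k ^ 2 * (t - 1)))) (by field_simp; ring) lt34)
    have s5 := map_lt_of_lt_cayley hF h1 s4
      (hP ((1 - k + k ^ 2 - k ^ 2 * t) / (1 - k * t)) _ (by field_simp) (n4.trans p5))
    have h5 : (1 - k + k ^ 2 - k ^ 2 * t) / (1 - k * t) ≤ t := by
      rw [div_le_iff₀ hb]
      nlinarith
    have := cayley_strictMono.monotone h5
    push_cast at s5
    linarith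
  · -- the word `PRQPR`
    have t0 : 0 < t := by linarith
    have lt34 : -((k * t + 1) / (k ^ 2 * (t + k))) < -(k / (k * t + 1 + k ^ 2)) := by
      rw [neg_lt_neg_iff, div_lt_div_iff₀ (by positivity) (by positivity)]
      have : 0 < k * t := by positivity
      have hk4 : k ^ 3 * k < 1 := by nlinarith [pow_pos hk 3]
      nlinarith [mul_pos this this, mul_pos hk hk, mul_pos this (mul_pos hk hk)]
    have n1 : -((k * t + 1) / (t + k)) < 0 := by
      have : 0 < (k * t + 1) / (t + k) := by positivity
      linarith
    have p2 : 0 < k * (t + k) / (k * t + 1) := by positivity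
    have n3 : -((k * t + 1) / (k ^ 2 * (t + k))) < 0 := by
      have : 0 < (k * t + 1) / (k ^ 2 * (t + k)) := by positivity
      linarith
    have n4 : -(k / (k * t + 1 + k ^ 2)) < 0 := by
      have : 0 < k / (k * t + 1 + k ^ 2) := by positivity
      linarith
    have p5 : 0 < k * t + 1 + k ^ 2 := by positivity
    have s1 : F (cayley t) ≤ cayley (-((k * t + 1) / (t + k))) + (1 : ℕ) := by
      simpa using (hR' _ _ (by field_simp; ring) (n1.trans t0)).le
    have s2 := map_le_of_le_cayley hF h1 s1
      (hP (k * (t + k) / (k * t + 1)) _ (by field_simp) (n1.trans p2))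
    have s3 := map_le_of_le_cayley hF h1 s2
      (hQ (-((k * t + 1) / (k ^ 2 * (t + k)))) _ (by field_simp) (n3.trans p2))
    have s4 := map_lt_of_le_cayley hF h1 (y := F (F (F (cayley t)))) (n := 2)
      (by push_cast at s3 ⊢; linarith)
      (hR (-(k / (k * t + 1 + k ^ 2))) (-((k * t + 1) / (k ^ 2 * (t + k))))
        (by field_simp; ring) lt34)
    have s5 := map_lt_of_lt_cayley hF h1 s4
      (hP (k * t + 1 + k ^ 2) _ (by field_simp) (n4.trans p5))
    -- The claim is (1 - k)t ≥ 1 + k². It follows from kt > 1 - k + k², because (1 - k)(1 - k + k²)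
    -- > k(1 + k²) for k < 1/9.
    have h5 : k * t + 1 + k ^ 2 ≤ t := by
      by_contra! hcon
      have : k * ((1 - k) * t) < k * (1 + k ^ 2) := mul_lt_mul_of_pos_left (by linarith) hk
      nlinarith [pow_pos hk 3]
    have := cayley_strictMono.monotone h5
    push_cast at s5
    linarith

end Words

lemma triLift_normal_iterate_five_lt {p h : ℝ} (hp : 4 / 5 < p) (hp1 : p < 1)
    (hh : (1 - p) / (1 + p) < h) (hh1 : h < 1) (x : ℝ) :
    (triLift (-(p : ℂ)) p (h * Complex.I))^[5] x < x + 2 := by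
  obtain ⟨k, hk⟩ : ∃ k, k = (1 - p) / (1 + p) := ⟨_, rfl⟩
  have hk0 : 0 < k := by
    rw [hk]
    exact div_pos (by linarith) (by linarith)
  have hk9 : k < 1 / 9 := by
    rw [hk, div_lt_iff₀ (by linarith)]
    linarith
  have hpk : p * (1 + k) = 1 - k := by
    have : (1 + p) ≠ 0 := by linarith
    rw [hk]
    field_simp
    ring
  rw [← hk] at hh
  have hPd : -(p : ℂ) ∈ disk := by
    rw [← Complex.ofReal_neg, ofReal_mem_disk, abs_neg, abs_of_pos (by linarith)]
    exact hp1
  have hQd : (p : ℂ) ∈ disk := by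
    rw [ofReal_mem_disk, abs_of_pos (by linarith)]
    exact hp1
  have hRd : (h : ℂ) * Complex.I ∈ disk := by
    rw [ofReal_mul_I_mem_disk, abs_of_pos (hk0.trans hh)]
    exact hh1
  have hSd : (k : ℂ) * Complex.I ∈ disk := by
    rw [ofReal_mul_I_mem_disk, abs_of_pos hk0]
    linarith
  have lt := triLift_lt_of_interior (by linarith) hp1 hk0 hh hh1
  refine iterate_five_lt_of_involutions hk0 hk9 (triLift_strictMono hPd hQd hRd)
    (continuous_triLift hPd hQd hRd) triLift_add_one ?_ ?_ ?_ ?_ ?_ ?_ x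
  · intro s t hst hlt
    rw [← chordLift_cayley_of_lt hPd (involution_left hpk hst) hlt]
    exact min_le_left _ _
  · intro s t hst hlt
    rw [← chordLift_cayley_of_gt hQd (involution_right hpk hk0 hst) hlt]
    exact (min_le_right _ _).trans (min_le_left _ _)
  · intro s t hst hlt
    rw [← chordLift_cayley_of_lt hSd (involution_top hst) hlt]
    exact lt _
  · intro s t hst hlt
    rw [← chordLift_cayley_of_gt hSd (involution_top hst) hlt]
    exact lt _
  · rw [← chordLift_ofReal_cayley_zero hQd]
    exact (min_le_right _ _).trans (min_le_left _ _)
  · rw [← chordLift_mul_I_zero hk0 (by linarith)]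
    exact lt _

/-! ### The distance of the Beltrami-Klein model -/

lemma inner_eq_re_add_im (u w : ℂ) : inner ℝ u w = u.re * w.re + u.im * w.im := by
  rw [Complex.inner]
  simp [Complex.mul_re]
  ring

lemma norm_sq_eq_re_add_im (u : ℂ) : ‖u‖ ^ 2 = u.re * u.re + u.im * u.im := by
  rw [Complex.sq_norm, Complex.normSq_apply]

lemma norm_sq_lt_one {u : ℂ} (hu : u ∈ disk) : ‖u‖ ^ 2 < 1 := by
  have := mem_disk.mp hu
  nlinarith [norm_nonneg u]

lemma one_sub_inner_pos {u w : ℂ} (hu : u ∈ disk) (hw : w ∈ disk) : 0 < 1 - inner ℝ u w := by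
  have h := real_inner_le_norm u w
  have hu' := mem_disk.mp hu
  have hw' := mem_disk.mp hw
  nlinarith [norm_nonneg u, norm_nonneg w]

/-- The square of the hyperbolic secant of `kleinDist P Q`. -/
def sechSq (P Q : ℂ) : ℝ := (1 - ‖P‖ ^ 2) * (1 - ‖Q‖ ^ 2) / (1 - inner ℝ P Q) ^ 2

lemma sechSq_pos {P Q : ℂ} (hP : P ∈ disk) (hQ : Q ∈ disk) : 0 < sechSq P Q := by
  have h1 := norm_sq_lt_one hP
  have h2 := norm_sq_lt_one hQ
  have h3 := one_sub_inner_pos hP hQ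
  exact div_pos (mul_pos (by linarith) (by linarith)) (by positivity)

lemma disc_eq (P Q : ℂ) :
    disc P Q = (1 - inner ℝ P Q) ^ 2 - (1 - ‖P‖ ^ 2) * (1 - ‖Q‖ ^ 2) := by
  rw [disc, coefA, coefB, norm_sq_eq_re_add_im, norm_sq_eq_re_add_im, norm_sq_eq_re_add_im,
    inner_eq_re_add_im, inner_eq_re_add_im]
  simp only [Complex.sub_re, Complex.sub_im]
  ring

lemma disc_nonneg {P Q : ℂ} (hP : P ∈ disk) : 0 ≤ disc P Q := by
  have h := norm_sq_lt_one hP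
  have hA : 0 ≤ coefA P Q := by
    unfold coefA
    positivity
  unfold disc
  nlinarith [sq_nonneg (coefB P Q)]

lemma one_sub_sechSq {P Q : ℂ} (hP : P ∈ disk) (hQ : Q ∈ disk) :
    1 - sechSq P Q = (√(disc P Q) / (1 - inner ℝ P Q)) ^ 2 := by
  have h3 := (one_sub_inner_pos hP hQ).ne'
  rw [div_pow, Real.sq_sqrt (disc_nonneg hP), disc_eq, sechSq]
  field_simp

lemma sechSq_le_one {P Q : ℂ} (hP : P ∈ disk) (hQ : Q ∈ disk) : sechSq P Q ≤ 1 := by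
  have := one_sub_sechSq hP hQ
  have h := sq_nonneg (√(disc P Q) / (1 - inner ℝ P Q))
  linarith

lemma sqrt_one_sub_sechSq_mem {P Q : ℂ} (hP : P ∈ disk) (hQ : Q ∈ disk) :
    √(1 - sechSq P Q) ∈ Set.Ioo (-1 : ℝ) 1 := by
  have h := sechSq_pos hP hQ
  refine ⟨by linarith [Real.sqrt_nonneg (1 - sechSq P Q)], ?_⟩
  rw [Real.sqrt_lt' one_pos]
  linarith

/-- With c = 1 - ⟨P, Q⟩ and s the root of `disc P Q`, the cross ratio is (c + s)/(c - s), and s/c is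
the hyperbolic tangent of the distance. -/
lemma kleinDist_eq_artanh {P Q : ℂ} (hP : P ∈ disk) (hQ : Q ∈ disk) :
    kleinDist P Q = Real.artanh √(1 - sechSq P Q) := by
  rcases eq_or_ne P Q with rfl | hne
  · have h : disc P P = 0 := by
      rw [disc_eq, real_inner_self_eq_norm_sq]
      ring
    rw [one_sub_sechSq hP hP, h]
    -- For P = Q both ends degenerate to P, the quotient is 0/0 = 0, and log 0 = 0.
    simp [kleinDist, endP, endQ]
  have hL : 0 < ‖Q - P‖ := norm_pos_iff.mpr (sub_ne_zero.mpr hne.symm)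
  set A := coefA P Q with hA
  set B := coefB P Q with hB
  set s := √(disc P Q) with hs
  set c := 1 - inner ℝ P Q with hc
  have hA0 : 0 < A := by
    rw [hA, coefA]
    positivity
  have hs2 : s ^ 2 = disc P Q := Real.sq_sqrt (disc_nonneg hP)
  have hd : disc P Q = B ^ 2 - A * (‖P‖ ^ 2 - 1) := rfl
  have hcB : c = 1 - ‖P‖ ^ 2 - B := by
    rw [hc, hB, coefB, inner_sub_right, real_inner_self_eq_norm_sq]
    ring
  have hQn : ‖Q‖ ^ 2 = A + 2 * B + ‖P‖ ^ 2 := by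
    rw [hA, hB, coefA, coefB, norm_sub_sq_real, inner_sub_right, real_inner_self_eq_norm_sq,
      real_inner_comm]
    ring
  have hP1 := norm_sq_lt_one hP
  have hQ1 := norm_sq_lt_one hQ
  have hc0 : 0 < c := one_sub_inner_pos hP hQ
  have hs0 : 0 ≤ s := Real.sqrt_nonneg _
  have hsB : |B| < s := abs_lt_of_sq_lt_sq (by nlinarith) hs0
  have hsAB : |A + B| < s := abs_lt_of_sq_lt_sq (by nlinarith) hs0
  rw [abs_lt] at hsB hsAB
  have hsc : s < c := by
    have h2 := norm_sq_lt_one hQ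
    refine lt_of_pow_lt_pow_left₀ 2 hc0.le ?_
    rw [hs2, disc_eq]
    nlinarith [mul_pos (sub_pos.mpr hP1) (sub_pos.mpr h2)]
  have hdP : ∀ r : ℝ, dist (P + (r : ℂ) * (Q - P)) P = |r| * ‖Q - P‖ := fun r => by
    rw [dist_eq_norm, add_sub_cancel_left, norm_mul, Complex.norm_real, Real.norm_eq_abs]
  have hdQ : ∀ r : ℝ, dist (P + (r : ℂ) * (Q - P)) Q = |1 - r| * ‖Q - P‖ := fun r => by
    rw [dist_comm, dist_eq_norm, ← Real.norm_eq_abs, ← Complex.norm_real, ← norm_mul]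
    congr 1
    push_cast
    ring
  have hratio : (dist (endP P Q) Q * dist (endQ P Q) P) /
      (dist (endP P Q) P * dist (endQ P Q) Q) = (1 + s / c) / (1 - s / c) := by
    rw [endP, endQ, hdP, hdP, hdQ, hdQ, ← hA, ← hB, ← hs]
    have a1 : |1 - (-B - s) / A| = (A + B + s) / A := by
      rw [show 1 - (-B - s) / A = (A + B + s) / A by field_simp; ring]
      exact abs_of_pos (div_pos (by linarith) hA0)
    have a2 : |(-B + s) / A| = (s - B) / A := by
      rw [show (-B + s) / A = (s - B) / A by ring]
      exact abs_of_pos (div_pos (by linarith) hA0)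
    have a3 : |(-B - s) / A| = (B + s) / A := by
      rw [show (-B - s) / A = -((B + s) / A) by ring, abs_neg]
      exact abs_of_pos (div_pos (by linarith) hA0)
    have a4 : |1 - (-B + s) / A| = (s - (A + B)) / A := by
      rw [show 1 - (-B + s) / A = -((s - (A + B)) / A) by field_simp; ring, abs_neg]
      exact abs_of_pos (div_pos (by linarith) hA0)
    rw [a1, a2, a3, a4]
    have b1 : B + s ≠ 0 := by linarith
    have b2 : s - (A + B) ≠ 0 := by linarith
    have b3 : c - s ≠ 0 := by linarith
    have b4 : 1 - s / c ≠ 0 := by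
      have : s / c < 1 := (div_lt_one hc0).mpr hsc
      linarith
    rw [show (1 + s / c) / (1 - s / c) = (c + s) / (c - s) by
      rw [div_eq_div_iff b4 b3]
      field_simp]
    rw [div_eq_div_iff (by positivity) b3]
    field_simp
    have e1 : (A + B + s) * (s - B) = A * (c + s) := by
      rw [hcB]
      linear_combination hs2 + hd
    have e2 : (B + s) * (s - (A + B)) = A * (c - s) := by
      rw [hcB]
      linear_combination hs2 + hd
    linear_combination (c - s) * e1 - (c + s) * e2
  have ht0 : 0 ≤ s / c := by positivity
  have ht1 : s / c < 1 := (div_lt_one hc0).mpr hsc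
  rw [kleinDist, hratio, one_sub_sechSq hP hQ, Real.sqrt_sq ht0,
    Real.artanh_eq_half_log ⟨by linarith, ht1.le⟩, abs_of_nonneg]
  apply Real.log_nonneg
  rw [le_div_iff₀ (by linarith)]
  linarith

lemma sechSq_eq_of_kleinDist_eq {P Q R S : ℂ} (hP : P ∈ disk) (hQ : Q ∈ disk) (hR : R ∈ disk)
    (hS : S ∈ disk) (h : kleinDist P Q = kleinDist R S) : sechSq P Q = sechSq R S := by
  rw [kleinDist_eq_artanh hP hQ, kleinDist_eq_artanh hR hS] at h
  have h2 := Real.artanh_injOn (sqrt_one_sub_sechSq_mem hP hQ) (sqrt_one_sub_sechSq_mem hR hS) h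
  have h3 := (Real.sqrt_inj (by linarith [sechSq_le_one hP hQ])
    (by linarith [sechSq_le_one hR hS])).mp h2
  linarith

lemma kleinDist_eq_of_sechSq_eq {P Q R S : ℂ} (hP : P ∈ disk) (hQ : Q ∈ disk) (hR : R ∈ disk)
    (hS : S ∈ disk) (h : sechSq P Q = sechSq R S) : kleinDist P Q = kleinDist R S := by
  rw [kleinDist_eq_artanh hP hQ, kleinDist_eq_artanh hR hS, h]

lemma kleinDist_zero_right {u : ℂ} (hu : u ∈ disk) : kleinDist u 0 = Real.artanh ‖u‖ := by
  rw [kleinDist_eq_artanh hu (mem_disk.mpr (by simp)), sechSq]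
  congr 1
  simp

lemma exp_kleinDist_neg {u : ℂ} (hu : u ∈ disk) :
    Real.exp (kleinDist u (-u)) = (1 + ‖u‖) / (1 - ‖u‖) := by
  have hu' : -u ∈ disk := by simpa [mem_disk] using hu
  have h1 := mem_disk.mp hu
  have h0 := norm_nonneg u
  have hs : √(1 - sechSq u (-u)) = 2 * ‖u‖ / (1 + ‖u‖ ^ 2) := by
    rw [← Real.sqrt_sq (by positivity : 0 ≤ 2 * ‖u‖ / (1 + ‖u‖ ^ 2)), sechSq, inner_neg_right,
      real_inner_self_eq_norm_sq, norm_neg, sub_neg_eq_add]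
    congr 1
    field_simp
    ring
  have hm := sqrt_one_sub_sechSq_mem hu hu'
  rw [kleinDist_eq_artanh hu hu', Real.exp_artanh hm, hs,
    ← Real.sqrt_sq (by apply div_nonneg <;> linarith : 0 ≤ (1 + ‖u‖) / (1 - ‖u‖))]
  rw [hs] at hm
  congr 1
  have h2 : 1 - 2 * ‖u‖ / (1 + ‖u‖ ^ 2) ≠ 0 := by linarith [hm.2]
  have h3 : 1 - ‖u‖ ≠ 0 := by linarith
  rw [div_pow, div_eq_div_iff h2 (pow_ne_zero 2 h3)]
  field_simp
  ring

lemma delta_le_kleinDist {P Q R S : ℂ} (hS : S ∈ line[ℝ, P, Q]) (hS1 : S ∈ disk) :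
    delta P Q R ≤ kleinDist R S := by
  refine csInf_le ⟨0, ?_⟩ ⟨S, ⟨hS, hS1⟩, rfl⟩
  rintro _ ⟨T, -, rfl⟩
  simp only [kleinDist]
  positivity

/-! ### Point reflections of the disk -/

/-- The denominator of `pointReflection a`. -/
def reflDen (a u : ℂ) : ℝ := 1 + ‖a‖ ^ 2 - 2 * inner ℝ a u

/-- The projective automorphism of the disk that extends the involution of the circle
through `a`. -/
def pointReflection (a u : ℂ) : ℂ := (2 * a - u - a ^ 2 * conj u) / reflDen a u

lemma reflDen_pos {a u : ℂ} (ha : a ∈ disk) (hu : u ∈ disk) : 0 < reflDen a u := by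
  have h := real_inner_le_norm a u
  have ha' := mem_disk.mp ha
  have hu' := mem_disk.mp hu
  unfold reflDen
  nlinarith [norm_nonneg u, norm_nonneg a, sq_nonneg (1 - ‖a‖), sq_nonneg (‖u‖ - ‖a‖)]

lemma coe_reflDen (a u : ℂ) : (reflDen a u : ℂ) = 1 + a * conj a - conj a * u - a * conj u := by
  apply Complex.ext
  · simp only [reflDen, norm_sq_eq_re_add_im, inner_eq_re_add_im, Complex.ofReal_re,
      Complex.add_re, Complex.sub_re, Complex.mul_re, Complex.one_re, Complex.conj_re,
      Complex.conj_im]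
    ring
  · simp only [Complex.ofReal_im, Complex.add_im, Complex.sub_im, Complex.mul_im, Complex.one_im,
      Complex.conj_re, Complex.conj_im]
    ring

lemma reflDen_mul_pointReflection {a u : ℂ} (ha : a ∈ disk) (hu : u ∈ disk) :
    (reflDen a u : ℂ) * pointReflection a u = 2 * a - u - a ^ 2 * conj u := by
  have : (reflDen a u : ℂ) ≠ 0 := by exact_mod_cast (reflDen_pos ha hu).ne'
  rw [pointReflection, mul_div_cancel₀ _ this]

/-- In homogeneous coordinates the reflection is linear and multiplies the Lorentz form 1 - ⟨u, w⟩
by (1 - ‖a‖²)². Therefore `sechSq`, a ratio of degree zero in each point, is invariant. -/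
lemma one_sub_inner_pointReflection {a u w : ℂ} (ha : a ∈ disk) (hu : u ∈ disk) (hw : w ∈ disk) :
    reflDen a u * reflDen a w * (1 - inner ℝ (pointReflection a u) (pointReflection a w)) =
      (1 - ‖a‖ ^ 2) ^ 2 * (1 - inner ℝ u w) := by
  have h : reflDen a u * reflDen a w * inner ℝ (pointReflection a u) (pointReflection a w) =
      inner ℝ (2 * a - u - a ^ 2 * conj u) (2 * a - w - a ^ 2 * conj w) := by
    rw [← reflDen_mul_pointReflection ha hu, ← reflDen_mul_pointReflection ha hw,
      ← Complex.real_smul, ← Complex.real_smul, real_inner_smul_left, real_inner_smul_right]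
    ring
  rw [mul_sub, mul_one, h]
  simp only [reflDen, norm_sq_eq_re_add_im a]
  simp only [inner_eq_re_add_im, Complex.sub_re, Complex.sub_im, Complex.mul_re, Complex.mul_im, Complex.conj_re, Complex.conj_im, pow_two, Complex.re_ofNat,
    Complex.im_ofNat]
  ring

lemma one_sub_norm_sq_pointReflection {a u : ℂ} (ha : a ∈ disk) (hu : u ∈ disk) :
    reflDen a u ^ 2 * (1 - ‖pointReflection a u‖ ^ 2) = (1 - ‖a‖ ^ 2) ^ 2 * (1 - ‖u‖ ^ 2) := by
  have := one_sub_inner_pointReflection ha hu hu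
  rw [real_inner_self_eq_norm_sq, real_inner_self_eq_norm_sq] at this
  rw [← this]
  ring

lemma pointReflection_mem_disk {a u : ℂ} (ha : a ∈ disk) (hu : u ∈ disk) :
    pointReflection a u ∈ disk := by
  have h := one_sub_norm_sq_pointReflection ha hu
  have h1 : 0 < (1 - ‖a‖ ^ 2) ^ 2 * (1 - ‖u‖ ^ 2) := by
    have := norm_sq_lt_one ha
    have := norm_sq_lt_one hu
    exact mul_pos (pow_pos (by linarith) 2) (by linarith)
  rw [← h] at h1
  have h2 := pos_of_mul_pos_right h1 (sq_nonneg _)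
  rw [mem_disk]
  nlinarith [norm_nonneg (pointReflection a u)]

lemma kleinDist_pointReflection {a u w : ℂ} (ha : a ∈ disk) (hu : u ∈ disk) (hw : w ∈ disk) :
    kleinDist (pointReflection a u) (pointReflection a w) = kleinDist u w := by
  have hu' := pointReflection_mem_disk ha hu
  have hw' := pointReflection_mem_disk ha hw
  refine kleinDist_eq_of_sechSq_eq hu' hw' hu hw ?_
  have i1 := one_sub_inner_pos hu hw
  have i2 := one_sub_inner_pos hu' hw'
  have e0 := one_sub_inner_pointReflection ha hu hw
  have e1 := one_sub_norm_sq_pointReflection ha hu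
  have e2 := one_sub_norm_sq_pointReflection ha hw
  have d1 := reflDen_pos ha hu
  have d2 := reflDen_pos ha hw
  have hn : 0 < 1 - ‖a‖ ^ 2 := by linarith [norm_sq_lt_one ha]
  rw [sechSq, sechSq, div_eq_div_iff (by positivity) (by positivity)]
  generalize 1 - ‖pointReflection a u‖ ^ 2 = a1 at *
  generalize 1 - ‖pointReflection a w‖ ^ 2 = a2 at *
  generalize 1 - inner ℝ (pointReflection a u) (pointReflection a w) = a3 at *
  generalize 1 - inner ℝ u w = a4 at *
  generalize reflDen a u = x at *
  generalize reflDen a w = y at *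
  apply mul_left_cancel₀ (show x ^ 2 * y ^ 2 * (1 - ‖a‖ ^ 2) ^ 4 ≠ 0 by positivity)
  calc x ^ 2 * y ^ 2 * (1 - ‖a‖ ^ 2) ^ 4 * (a1 * a2 * a4 ^ 2)
      = (x ^ 2 * a1) * (y ^ 2 * a2) * ((1 - ‖a‖ ^ 2) ^ 2 * a4) ^ 2 := by ring
    _ = _ := by rw [e1, e2, ← e0]; ring

/-- Conjugation by the involution through `a` acts on the involutions through points as the point
reflection about `a`. -/
lemma chordLift_chordLift_pointReflection {a u : ℂ} (ha : a ∈ disk) (hu : u ∈ disk) (x : ℝ) :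
    chordLift u (chordLift a x) = chordLift a (chordLift (pointReflection a u) x) := by
  have hu' := pointReflection_mem_disk ha hu
  have m1 := chordLift_mem hu' x
  have hproj : proj (chordLift u (chordLift a x)) =
      proj (chordLift a (chordLift (pointReflection a u) x)) := by
    apply proj_chordLift_eq hu
    have hz := proj_chordLift_mul a (chordLift (pointReflection a u) x)
    have hw := proj_chordLift_mul (pointReflection a u) x
    have hy := proj_chordLift_mul a x
    have hN := reflDen_mul_pointReflection ha hu
    have hNc := congrArg conj hN
    have hs := sight_ne_zero ha (proj x)
    have hn : 1 - a * conj a ≠ 0 := by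
      rw [Complex.mul_conj']
      have := norm_sq_lt_one ha
      have h : (1 : ℝ) - ‖a‖ ^ 2 ≠ 0 := by linarith
      exact_mod_cast h
    simp only [map_mul, map_sub, map_pow, Complex.conj_conj, Complex.conj_ofReal,
      Complex.conj_ofNat] at hNc
    rw [coe_reflDen] at hN hNc
    unfold sight at *
    generalize (proj (chordLift a (chordLift (pointReflection a u) x)) : ℂ) = z at *
    generalize (proj (chordLift (pointReflection a u) x) : ℂ) = w at *
    generalize (proj (chordLift a x) : ℂ) = y at *
    generalize (proj x : ℂ) = v at *
    generalize pointReflection a u = u' at *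
    generalize conj u' = u'' at *
    generalize conj u = ub at *
    generalize conj a = ab at *
    have key : z * (1 - a * ub + v * ub - v * ab) = u - a + v - v * ab * u := by
      apply mul_left_cancel₀ hn
      linear_combination (1 - u'' * v) * (1 + a * ab - ab * u - a * ub) * hz +
        (z * ab - 1) * (1 + a * ab - ab * u - a * ub) * hw +
        (z * v - a * v) * hNc + (z * ab - 1) * hN
    apply mul_right_cancel₀ hs
    linear_combination key + (1 - z * ub) * hy
  have m2 := chordLift_mem hu (chordLift a x)
  -- Both lifts lie between `chordLift a x` and `chordLift a (x + 1)`, so no integer ambiguity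
  -- remains.
  refine eq_of_proj_eq (x := chordLift a x) hproj m2 ⟨strictMono_chordLift ha m1.1, ?_⟩
  rw [← chordLift_add_one]
  exact strictMono_chordLift ha m1.2

lemma chordLift_rotate (u : ℂ) (θ x : ℝ) :
    chordLift (proj θ * u) (x + θ) = chordLift u x + θ := by
  have h : sight (proj θ * u) (proj (x + θ)) = sight u (proj x) := by
    have : conj (proj θ : ℂ) * (proj θ : ℂ) = 1 := by
      rw [Complex.conj_mul', Circle.norm_coe]
      simp
    simp only [sight, proj_add, Circle.coe_mul, map_mul]
    linear_combination (-conj u * proj x) * this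
  rw [chordLift, chordLift, h]
  ring

/-! ### Transfer along conjugations -/

lemma triLift_iterate_five_lt_of_semiconj {P Q R P' Q' R' : ℂ} {G : ℝ → ℝ} (hG : StrictMono G)
    (hsurj : Function.Surjective G) (h1 : ∀ x, G (x + 1) = G x + 1)
    (hP : ∀ x, chordLift P (G x) = G (chordLift P' x))
    (hQ : ∀ x, chordLift Q (G x) = G (chordLift Q' x))
    (hR : ∀ x, chordLift R (G x) = G (chordLift R' x))
    (h : ∀ x, (triLift P' Q' R')^[5] x < x + 2) (x : ℝ) : (triLift P Q R)^[5] x < x + 2 := by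
  have hs : Function.Semiconj G (triLift P' Q' R') (triLift P Q R) := fun x => by
    simp only [triLift, hG.monotone.map_min, hP, hQ, hR]
  obtain ⟨y, rfl⟩ := hsurj x
  have h2 := map_add_natCast_of_map_add_one h1 y 2
  push_cast at h2
  rw [← hs.iterate_right 5 y, ← h2]
  exact hG (h y)

lemma triLift_iterate_five_lt_of_pointReflection {a P Q R : ℂ} (ha : a ∈ disk) (hP : P ∈ disk)
    (hQ : Q ∈ disk) (hR : R ∈ disk)
    (h : ∀ x, (triLift (pointReflection a P) (pointReflection a Q)
      (pointReflection a R))^[5] x < x + 2) (x : ℝ) : (triLift P Q R)^[5] x < x + 2 :=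
  triLift_iterate_five_lt_of_semiconj (strictMono_chordLift ha)
    (fun y => ⟨chordLift a (y - 1), by rw [chordLift_chordLift ha, sub_add_cancel]⟩)
    (chordLift_add_one a) (chordLift_chordLift_pointReflection ha hP)
    (chordLift_chordLift_pointReflection ha hQ) (chordLift_chordLift_pointReflection ha hR) h x

lemma triLift_iterate_five_lt_of_rotate {P Q R : ℂ} (c : Circle)
    (h : ∀ x, (triLift P Q R)^[5] x < x + 2) (x : ℝ) :
    (triLift (c * P) (c * Q) (c * R))^[5] x < x + 2 := by
  obtain ⟨θ, rfl⟩ := proj_surjective c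
  exact triLift_iterate_five_lt_of_semiconj (G := fun x => x + θ) (fun _ _ h => by simpa using h)
    (fun y => ⟨y - θ, by simp⟩) (fun x => by ring) (fun x => chordLift_rotate P θ x)
    (fun x => chordLift_rotate Q θ x) (fun x => chordLift_rotate R θ x) h x

lemma triLift_swap (P Q R : ℂ) : triLift P Q R = triLift Q P R := by
  funext x
  simp only [triLift]
  rw [min_left_comm]

/-- An isosceles triangle with `0` as the midpoint of its base. -/
lemma triLift_centered_iterate_five_lt {P R : ℂ} (hP : P ∈ disk) (hR : R ∈ disk)
    (hperp : inner ℝ P R = 0) (hlarge : 4 / 5 < ‖P‖)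
    (hheight : (1 - ‖P‖) / (1 + ‖P‖) < ‖R‖) (x : ℝ) : (triLift P (-P) R)^[5] x < x + 2 := by
  have hP1 := mem_disk.mp hP
  have hR1 := mem_disk.mp hR
  have hR0 : 0 < ‖R‖ := (div_pos (by linarith) (by linarith)).trans hheight
  have hR0' : (‖R‖ : ℂ) ≠ 0 := by exact_mod_cast hR0.ne'
  obtain ⟨c, hc⟩ : ∃ c : Circle, R = c * (‖R‖ * Complex.I) := by
    refine ⟨⟨R / (‖R‖ * Complex.I), ?_⟩, ?_⟩
    · rw [Submonoid.unitSphere, ← SetLike.mem_coe]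
      simp [hR0.ne']
    · rw [div_mul_cancel₀]
      exact mul_ne_zero hR0' Complex.I_ne_zero
  obtain ⟨z, hz⟩ : ∃ z : ℂ, P = c * z :=
    ⟨P / c, by rw [mul_div_cancel₀ _ (Circle.coe_ne_zero c)]⟩
  have hcc : (c : ℂ).re ^ 2 + (c : ℂ).im ^ 2 = 1 := by
    have h := Circle.normSq_coe c
    rw [Complex.normSq_apply] at h
    linarith
  have him : z.im = 0 := by
    rw [inner_eq_re_add_im, hc, hz] at hperp
    simp only [Complex.mul_re, Complex.mul_im, Complex.ofReal_re, Complex.ofReal_im,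
      Complex.I_re, Complex.I_im] at hperp
    have : ‖R‖ * z.im = 0 := by linear_combination hperp - ‖R‖ * z.im * hcc
    exact (mul_eq_zero.mp this).resolve_left hR0.ne'
  have hzr : z = (z.re : ℂ) := Complex.ext (by simp) (by simpa using him)
  have hzn : |z.re| = ‖P‖ := by
    rw [hz, norm_mul, Circle.norm_coe, one_mul]
    conv_rhs => rw [hzr]
    rw [Complex.norm_real, Real.norm_eq_abs]
  have main := triLift_iterate_five_lt_of_rotate c
    (triLift_normal_iterate_five_lt hlarge hP1 hheight hR1)
  rw [← hc] at main
  rcases abs_choice z.re with h | h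
  · have e : P = c * (‖P‖ : ℂ) := by
      rw [← hzn, h, ← hzr]
      exact hz
    rw [mul_neg, ← e] at main
    rw [triLift_swap]
    exact main x
  · have e : P = -(c * (‖P‖ : ℂ)) := by
      rw [← hzn, h]
      push_cast
      rw [← hzr, mul_neg, neg_neg]
      exact hz
    have e' : -P = c * (‖P‖ : ℂ) := by
      rw [neg_eq_iff_eq_neg]
      exact e
    rw [mul_neg, ← e, ← e'] at main
    exact main x

/-- The hyperbolic midpoint of `PQ` lies on the line `PQ`, and some point reflection moves it to
the center of the disk. -/
lemma exists_pointReflection_midpoint {P Q : ℂ} (hP : P ∈ disk) (hQ : Q ∈ disk) :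
    ∃ M ∈ line[ℝ, P, Q], M ∈ disk ∧ ∃ a ∈ disk, pointReflection a M = 0 ∧
      pointReflection a Q = -pointReflection a P := by
  have hP1 := norm_sq_lt_one hP
  have hQ1 := norm_sq_lt_one hQ
  obtain ⟨α, hα⟩ : ∃ α, α = √(1 - ‖P‖ ^ 2) := ⟨_, rfl⟩
  obtain ⟨β, hβ⟩ : ∃ β, β = √(1 - ‖Q‖ ^ 2) := ⟨_, rfl⟩
  have hα0 : 0 < α := by
    rw [hα]
    exact Real.sqrt_pos.mpr (by linarith)
  have hβ0 : 0 < β := by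
    rw [hβ]
    exact Real.sqrt_pos.mpr (by linarith)
  have hα2 : α ^ 2 = 1 - ‖P‖ ^ 2 := by rw [hα, Real.sq_sqrt (by linarith)]
  have hβ2 : β ^ 2 = 1 - ‖Q‖ ^ 2 := by rw [hβ, Real.sq_sqrt (by linarith)]
  have hαβ : (α : ℂ) + β ≠ 0 := by
    have : α + β ≠ 0 := by positivity
    exact_mod_cast this
  -- On the hyperboloid P and Q are the unit vectors (1, P)/α and (1, Q)/β; their sum projects to
  -- this M.
  obtain ⟨M, hM⟩ : ∃ M, M = AffineMap.lineMap P Q (α / (α + β)) := ⟨_, rfl⟩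
  have hMl : M ∈ line[ℝ, P, Q] := hM ▸ AffineMap.lineMap_mem_affineSpan_pair _ _ _
  have hMe : (α + β) * M = β * P + α * Q := by
    rw [hM, AffineMap.lineMap_apply]
    simp only [vsub_eq_sub, vadd_eq_add, Complex.real_smul]
    push_cast
    field_simp
    ring
  have hMd : M ∈ disk := by
    rw [hM]
    refine (convex_ball (0 : ℂ) 1).lineMap_mem hP hQ ⟨by positivity, ?_⟩
    rw [div_le_one (by positivity)]
    linarith
  have hM1 := norm_sq_lt_one hMd
  obtain ⟨γ, hγ⟩ : ∃ γ, γ = √(1 - ‖M‖ ^ 2) := ⟨_, rfl⟩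
  have hγ0 : 0 ≤ γ := hγ ▸ Real.sqrt_nonneg _
  have hγ2 : γ ^ 2 = 1 - ‖M‖ ^ 2 := by rw [hγ, Real.sq_sqrt (by linarith)]
  have hγ1 : (1 : ℂ) + γ ≠ 0 := by
    have : 1 + γ ≠ 0 := by positivity
    exact_mod_cast this
  -- Here a is the hyperbolic midpoint of 0 and M, by tanh(d/2) = tanh d/(1 + sech d) with γ = sech
  -- d.
  obtain ⟨a, ha⟩ : ∃ a : ℂ, a = M / (1 + γ) := ⟨_, rfl⟩
  have haM : M = (1 + γ) * a := by rw [ha, mul_div_cancel₀ _ hγ1]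
  have had : a ∈ disk := by
    have h : ‖M‖ = (1 + γ) * ‖a‖ := by
      rw [haM, norm_mul]
      congr 1
      have : (1 : ℂ) + γ = ((1 + γ : ℝ) : ℂ) := by push_cast; rfl
      rw [this, Complex.norm_real, Real.norm_of_nonneg (by positivity)]
    rw [mem_disk] at hMd ⊢
    nlinarith [norm_nonneg a]
  have hnum : 2 * a - M - a ^ 2 * conj M = 0 := by
    have hγ2' : (γ : ℂ) ^ 2 = 1 - M * conj M := by
      rw [Complex.mul_conj']
      exact_mod_cast hγ2
    rw [haM] at hγ2' ⊢
    simp only [map_mul, map_add, map_one, Complex.conj_ofReal] at hγ2' ⊢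
    apply mul_left_cancel₀ hγ1
    linear_combination -a * hγ2'
  refine ⟨M, hMl, hMd, a, had, by rw [pointReflection, hnum, zero_div], ?_⟩
  have nP := reflDen_mul_pointReflection had hP
  have nQ := reflDen_mul_pointReflection had hQ
  have hsum : (β * reflDen a P : ℂ) * pointReflection a P +
      (α * reflDen a Q : ℂ) * pointReflection a Q = 0 := by
    have hMc := congrArg conj hMe
    simp only [map_mul, map_add, Complex.conj_ofReal] at hMc
    linear_combination β * nP + α * nQ + hMe + a ^ 2 * hMc + (α + β) * hnum
  have sP := one_sub_norm_sq_pointReflection had hP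
  have sQ := one_sub_norm_sq_pointReflection had hQ
  have dP := reflDen_pos had hP
  have dQ := reflDen_pos had hQ
  have hnorm : β * reflDen a P * ‖pointReflection a P‖ =
      α * reflDen a Q * ‖pointReflection a Q‖ := by
    have h := congrArg norm (eq_neg_of_add_eq_zero_left hsum)
    simp only [norm_neg, norm_mul, Complex.norm_real, Real.norm_of_nonneg hα0.le,
      Real.norm_of_nonneg hβ0.le, Real.norm_of_nonneg dP.le, Real.norm_of_nonneg dQ.le] at h
    exact h
  rw [← hα2] at sP
  rw [← hβ2] at sQ
  -- By `hsum` the images are opposite in direction. Together with the scaling of 1 - ‖·‖², equality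
  -- of the weighted norms forces equal weights.
  have heq : β * reflDen a P = α * reflDen a Q := by
    have h2 : (β * reflDen a P) ^ 2 = (α * reflDen a Q) ^ 2 := by
      have h3 := congrArg (· ^ 2) hnorm
      simp only [mul_pow] at h3
      linear_combination β ^ 2 * sP - α ^ 2 * sQ + h3
    exact (sq_eq_sq₀ (by positivity) (by positivity)).mp h2
  have heq' : (β : ℂ) * reflDen a P = α * reflDen a Q := by exact_mod_cast heq
  have hne : (α : ℂ) * reflDen a Q ≠ 0 := by
    have : α * reflDen a Q ≠ 0 := by positivity
    exact_mod_cast this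
  rw [heq', ← mul_add] at hsum
  exact eq_neg_of_add_eq_zero_right ((mul_eq_zero.mp hsum).resolve_left hne)

end BarBilliard

end

/-! ### Translation of the hypotheses to the centered triangle -/

theorem theorem6p15 (P Q R : ℂ)
    (hP : P ∈ BarBilliard.disk) (hQ : Q ∈ BarBilliard.disk) (hR : R ∈ BarBilliard.disk)
    (htri : AffineIndependent ℝ ![P, Q, R])
    (hiso : BarBilliard.kleinDist P R = BarBilliard.kleinDist Q R)
    (hlarge : Real.log 9 < BarBilliard.kleinDist P Q)
    (hheight : (1 / 2) * BarBilliard.Delta 1 P Q < BarBilliard.delta P Q R) :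
    ∃ ρ : ℝ, BarBilliard.HasRotationNumber
        (BarBilliard.psi (convexHull ℝ {P, Q, R})) ρ ∧ ρ < 2 / 5 := by
  open BarBilliard in
  obtain ⟨M, hMl, hMd, a, ha, hM0, hQP⟩ := exists_pointReflection_midpoint hP hQ
  refine exists_rotationNumber_lt hP hQ hR
    (triLift_iterate_five_lt_of_pointReflection ha hP hQ hR ?_)
  have hP' := pointReflection_mem_disk ha hP
  have hQ' := pointReflection_mem_disk ha hQ
  have hR' := pointReflection_mem_disk ha hR
  have hPQ := kleinDist_pointReflection ha hP hQ
  have hPR := kleinDist_pointReflection ha hP hR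
  have hQR := kleinDist_pointReflection ha hQ hR
  have hRM := kleinDist_pointReflection ha hR hMd
  have hδ := hheight.trans_le (delta_le_kleinDist hMl hMd)
  rw [hQP] at hQ' hPQ hQR ⊢
  rw [hM0, kleinDist_zero_right hR'] at hRM
  generalize pointReflection a P = P' at *
  generalize pointReflection a R = R' at *
  have hP1 := mem_disk.mp hP'
  have hR1 := mem_disk.mp hR'
  have hexp := exp_kleinDist_neg hP'
  rw [hPQ] at hexp
  have hp : 4 / 5 < ‖P'‖ := by
    have h := Real.exp_lt_exp.mpr hlarge
    rw [Real.exp_log (by norm_num), hexp, lt_div_iff₀ (by linarith)] at h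
    linarith
  refine triLift_centered_iterate_five_lt hP' hR' ?_ hp ?_
  -- Equal distances from R' to ±P' give 1 - ⟨P', R'⟩ = 1 + ⟨P', R'⟩, since all other factors of
  -- `sechSq` agree.
  · have h := sechSq_eq_of_kleinDist_eq hP' hR' hQ' hR' (by rw [hPR, hQR, hiso])
    have i1 := one_sub_inner_pos hP' hR'
    have i2 := one_sub_inner_pos hQ' hR'
    have n1 : 0 < (1 - ‖P'‖ ^ 2) * (1 - ‖R'‖ ^ 2) :=
      mul_pos (by linarith [norm_sq_lt_one hP']) (by linarith [norm_sq_lt_one hR'])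
    rw [sechSq, sechSq, norm_neg, div_eq_div_iff (by positivity) (by positivity)] at h
    have h2 := (sq_eq_sq₀ i2.le i1.le).mp (mul_left_cancel₀ n1.ne' h)
    rw [inner_neg_left] at h2
    linarith
  -- As exp(-d') = (1 - ‖P'‖)/(1 + ‖P'‖), half of `Delta 1 P Q` is the artanh of this number, to be
  -- compared with d'(R, M) = artanh ‖R'‖.
  · have hk : Delta 1 P Q =
        Real.log ((1 + (1 - ‖P'‖) / (1 + ‖P'‖)) / (1 - (1 - ‖P'‖) / (1 + ‖P'‖))) := by
      rw [Delta, Nat.cast_one, one_mul, hexp]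
      have h1 : 1 - ‖P'‖ ≠ 0 := by linarith
      have h2 : 1 + ‖P'‖ ≠ 0 := by linarith
      have h3 : ‖P'‖ ≠ 0 := by linarith
      congr 1
      rw [show (1 + ‖P'‖) / (1 - ‖P'‖) + 1 = 2 / (1 - ‖P'‖) by field_simp; ring,
        show (1 + ‖P'‖) / (1 - ‖P'‖) - 1 = 2 * ‖P'‖ / (1 - ‖P'‖) by field_simp; ring,
        show 1 + (1 - ‖P'‖) / (1 + ‖P'‖) = 2 / (1 + ‖P'‖) by field_simp; ring,
        show 1 - (1 - ‖P'‖) / (1 + ‖P'‖) = 2 * ‖P'‖ / (1 + ‖P'‖) by field_simp; ring]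
      field_simp
    have k0 : 0 < (1 - ‖P'‖) / (1 + ‖P'‖) := div_pos (by linarith) (by linarith)
    have k1 : (1 - ‖P'‖) / (1 + ‖P'‖) < 1 := by
      rw [div_lt_one (by linarith)]
      linarith
    rw [hk, ← Real.artanh_eq_half_log ⟨by linarith, k1.le⟩, ← hRM] at hδ
    exact (Real.artanh_lt_artanh_iff ⟨by linarith, k1⟩
      ⟨by linarith [norm_nonneg R'], hR1⟩).mp hδ
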